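/- Let $d\ge 1$ be an integer and let $c>0$ and $\nu>-1$ be real. Let $K_\nu$ be the modified Bessel function of the second kind and $J_\nu$ the Bessel function of the first kind; put $dA=\frac1\pi\,d\xi\,d\eta$ on $\mathbb{C}$ and $dA_N=(dA)^{\otimes N}$ on $\mathbb{C}^N$. For $N\ge 1$ let $$Q_N(\zeta)=\frac1N\log\frac{1}{K_\nu(N^2c^{-2}|\zeta|^d)\,|\zeta|^{d(\nu+2)-2}}-\Big(\frac{N}{c^2}-1\Big)\operatorname{Re}\zeta^d ,$$ $$H_N(\zeta_1,\dots,\zeta_N)=\sum_{j\ne k}\log\frac{1}{|\zeta_j^d-\zeta_k^d|}+N\sum_{j=1}^N Q_N(\zeta_j),$$ and let $\{\zeta_j\}_1^N$ be a random sample from the Gibbs measure $d\mathbf{P}_N=\frac1{Z_N}e^{-H_N}\,dA_N$, $Z_N=\int_{\mathbb{C}^N}e^{-H_N}\,dA_N$. Let $$\mathbf{R}_N(\zeta)=\lim_{\varepsilon\to0+}\varepsilon^{-2}\,\mathbf{E}_N\big[\#(\{\zeta_j\}_1^N\cap D(\zeta,\varepsilon))\big]$$ be its 1-point function, and let $R_N(z)=(c/N)^{4/d}\,\mathbf{R}_N\big((c/N)^{2/d}z\big)$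 be the 1-point function of the rescaled system $z_j=(N/c)^{2/d}\zeta_j$. For $z\neq0$ let $$R(z)=\frac d2\,|z|^{2d-2}K_\nu(|z|^d)\,e^{\operatorname{Re}z^d}\int_0^{2c}s\,e^{-s^2/2}\,|J_\nu(s\,z^{d/2})|^2\,ds ,$$ where all powers are principal branches (the modulus does not depend on the branch). Then: 1. For all sufficiently large $N$, $\mathbf{P}_N$ is a well-defined probability measure and the limit defining $\mathbf{R}_N(\zeta)$ exists (and is finite) for every $\zeta\ne0$; it also exists at $\zeta=0$ if $$\nu>0\quad\text{or}\quad\big(d\ge2\ \text{and}\ \nu\ge-\tfrac{d-1}{d}\big).\qquad(*)$$ 2. $R_N\to R$ uniformly on every compact subset of $\mathbb{C}\setminus\{0\}$. 3. If $(*)$ holds, then $R$ extends continuously to $z=0$ and, with this extension, $R_N\to R$ uniformly on every compact subset of $\mathbb{C}$. -/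

import Mathlib

open MeasureTheory Filter Topology Set

noncomputable section

namespace ChiralALUE

/-- The modified Bessel function of the second kind `K_ν(x)`, for real order `ν` and `x > 0`,
`K_ν(x) = ∫_0^∞ e^{-x cosh t} cosh(ν t) dt`.  (Only its values at `x > 0` are meaningful.) -/
def besselK (ν x : ℝ) : ℝ :=
  ∫ t in Ioi (0 : ℝ), Real.exp (-x * Real.cosh t) * Real.cosh (ν * t)

/-- The Bessel function of the first kind of real order `ν`,
`J_ν(w) = (w/2)^ν ∑_k (-1)^k (w/2)^{2k} / (k! Γ(ν+k+1))`, with the principal branch of the power. -/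
def besselJ (ν : ℝ) (w : ℂ) : ℂ :=
  (w / 2) ^ (ν : ℂ) *
    ∑' k : ℕ, (-1 : ℂ) ^ k / ((Nat.factorial k : ℂ) * (Real.Gamma (ν + k + 1) : ℂ)) *
      (w / 2) ^ (2 * k)

/-- The normalized area measure `dA = (1/π) dξ dη` on `ℂ`. -/
def areaMeasure : Measure ℂ := ENNReal.ofReal (Real.pi⁻¹) • (volume : Measure ℂ)

/-- The product measure `dA_N` on `ℂ^N`. -/
def areaMeasurePi (N : ℕ) : Measure (Fin N → ℂ) := Measure.pi fun _ => areaMeasure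

/-- The `d`-energy `∑_{j ≠ k} log (1 / |ζ_j^d - ζ_k^d|) + N ∑_j Q(ζ_j)` of an `N`-point
configuration.  (Configurations where some `ζ_j^d = ζ_k^d`, `j ≠ k`, form a null set.) -/
def energy (d N : ℕ) (Q : ℂ → ℝ) (x : Fin N → ℂ) : ℝ :=
  (∑ j : Fin N, ∑ k ∈ Finset.univ.filter (fun k => k ≠ j),
      Real.log (1 / ‖x j ^ d - x k ^ d‖)) + N * ∑ j : Fin N, Q (x j)

/-- The Boltzmann factor `e^{-β H}`. -/
def boltzmannFactor (d N : ℕ) (β : ℝ) (Q : ℂ → ℝ) (x : Fin N → ℂ) : ENNReal :=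
  ENNReal.ofReal (Real.exp (-(β * energy d N Q x)))

/-- The partition function `Z = ∫ e^{-β H} dA_N`. -/
def partitionFunction (d N : ℕ) (β : ℝ) (Q : ℂ → ℝ) : ENNReal :=
  ∫⁻ x, boltzmannFactor d N β Q x ∂(areaMeasurePi N)

/-- The Boltzmann-Gibbs measure `dP = Z⁻¹ e^{-β H} dA_N`. -/
def gibbsMeasure (d N : ℕ) (β : ℝ) (Q : ℂ → ℝ) : Measure (Fin N → ℂ) :=
  (partitionFunction d N β Q)⁻¹ • (areaMeasurePi N).withDensity (boltzmannFactor d N β Q)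

/-- The number of indices `j` such that `x_j` lies in the disc with centre `ζ` and radius `ε`. -/
def discCount {N : ℕ} (ζ : ℂ) (ε : ℝ) (x : Fin N → ℂ) : ℕ :=
  {j : Fin N | x j ∈ Metric.ball ζ ε}.ncard

/-- The quotient `E[#({ζ_j} ∩ D(ζ, ε))] / ε²`. -/
def intensityQuotient {N : ℕ} (P : Measure (Fin N → ℂ)) (ζ : ℂ) (ε : ℝ) : ℝ :=
  (∫ x, (discCount ζ ε x : ℝ) ∂P) / ε ^ 2

/-- The 1-point function `lim_{ε → 0+} E[#({ζ_j} ∩ D(ζ, ε))] / ε²` of an `N`-point system. -/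
def onePointFunction {N : ℕ} (P : Measure (Fin N → ℂ)) (ζ : ℂ) : ℝ :=
  limUnder (𝓝[>] (0 : ℝ)) (intensityQuotient P ζ)

/-- The potential `Q_{N,d}` of the chiral almost-Hermitian LUE-type ensemble. -/
def potential (d N : ℕ) (c ν : ℝ) (ζ : ℂ) : ℝ :=
  1 / (N : ℝ) *
      Real.log (1 / (besselK ν ((N : ℝ) ^ 2 / c ^ 2 * ‖ζ‖ ^ d) *
        ‖ζ‖ ^ ((d : ℝ) * (ν + 2) - 2)))
    - ((N : ℝ) / c ^ 2 - 1) * (ζ ^ d).re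

/-- The law of the ensemble `{ζ_j}_1^N` (inverse temperature `β = 1`). -/
def ensemble (d N : ℕ) (c ν : ℝ) : Measure (Fin N → ℂ) :=
  gibbsMeasure d N 1 (potential d N c ν)

/-- The 1-point function `R_N(z) = (c/N)^{4/d} 𝐑_N(ζ)`, `z = (N/c)^{2/d} ζ`, of the rescaled
system. -/
def rescaledOnePoint (d N : ℕ) (c ν : ℝ) (z : ℂ) : ℝ :=
  (c / N) ^ (4 / (d : ℝ)) *
    onePointFunction (ensemble d N c ν) ((((c / N) ^ (2 / (d : ℝ)) : ℝ) : ℂ) * z)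

/-- The formula for the limiting 1-point function at points `z ≠ 0`. -/
def limitFormula (d : ℕ) (c ν : ℝ) (z : ℂ) : ℝ :=
  (d : ℝ) / 2 * ‖z‖ ^ (2 * d - 2) * besselK ν (‖z‖ ^ d) * Real.exp (z ^ d).re *
    ∫ s in (0 : ℝ)..(2 * c),
      s * Real.exp (-s ^ 2 / 2) * ‖besselJ ν ((s : ℂ) * z ^ ((d : ℂ) / 2))‖ ^ 2

/-- The limiting 1-point function `R`: the formula at `z ≠ 0`, and its limit at `z = 0`. -/
def limitDensity (d : ℕ) (c ν : ℝ) : ℂ → ℝ :=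
  Function.update (limitFormula d c ν) 0 (limUnder (𝓝[≠] (0 : ℂ)) (limitFormula d c ν))

/-- The range of parameters for which the densities stay bounded near the origin: the factor
`|z|^{2d-2} K_ν(|z|^d) |z|^{dν}` is bounded near `0` exactly if this holds. -/
def BoundedAtOrigin (d : ℕ) (ν : ℝ) : Prop :=
  0 < ν ∨ (2 ≤ d ∧ -((d : ℝ) - 1) / d ≤ ν)

end ChiralALUE

end

namespace ChiralALUE

open ComplexConjugate

/-! Put `ζ = α z` with `α = (c/N)^{2/d}` and `τ = 1 - c²/N`. Then `e^{-N Q_N}` becomes a constant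
times `K_ν(|z|^d) |z|^{d(ν+2)-2} e^{τ Re z^d}`, and the interaction is the squared Vandermonde
determinant in the variables `z_j^d`. The ensemble is therefore determinantal, and its one-point
function is the weight times `∑_{n<N} |p_n(z^d)|² / ‖p_n‖²` for orthogonal polynomials `p_n` in `v =
z^d`.

The polynomials are Laguerre polynomials. The image of the radial weight under `z ↦ z^d` has moments
`∫ v^j v̄^k = δ_{jk} A 4^j j! Γ(j+ν+1)`, so `∫ e^{αv+βv̄}` is a multiple of `(1-4αβ)^{-(ν+1)}`
(`expMoment_zero_zero`). Derivatives in `α` produce powers of `v`; summed with the Laguerre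
coefficients they give a function of `β` with a zero of order `n` at `β = τ/2`. Derivatives in `β`
produce powers of `v̄`, so `p_n` is orthogonal to all lower degrees (`laguerreMoment_eq`,
`integral_laguerrePoly_orthogonal`).

The kernel sum is a Riemann sum in `x = n/N`. The Gamma quotients tend to `x^ν`, the factors
`τ^{2n}` to `e^{-2c²x}`, and the polynomials to a Bessel series (`tendsto_laguerrePoly`). Dominated
convergence is carried out jointly in `N` and the point, which yields both locally uniform
convergence and continuity of the limit. The substitution `x = s²/(4c²)` gives the stated formula.
The radial weight does not depend on `N`, so the origin only requires that this weight have a limit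
there, which `(*)` ensures. -/

/-! ### The modified Bessel function: integral forms, behaviour at zero, moments. -/

theorem one_add_sq_div_two_le_cosh (t : ℝ) : 1 + t ^ 2 / 2 ≤ Real.cosh t := by
  have h := Real.cosh_two_mul (t / 2)
  have h2 := Real.cosh_sq (t / 2)
  have h3 : |t / 2| ≤ |Real.sinh (t / 2)| := by
    rcases le_total 0 (t / 2) with h0 | h0
    · rw [abs_of_nonneg h0, abs_of_nonneg (Real.sinh_nonneg_iff.2 h0)]
      exact Real.self_le_sinh_iff.2 h0
    · rw [abs_of_nonpos h0, abs_of_nonpos (Real.sinh_nonpos_iff.2 h0)]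
      exact neg_le_neg (Real.sinh_le_self_iff.2 h0)
  have h4 := sq_le_sq.2 h3
  rw [show 2 * (t / 2) = t by ring] at h
  nlinarith

theorem exp_cosh_le_gaussian {x : ℝ} (hx : 0 < x) (μ t : ℝ) :
    Real.exp (-x * Real.cosh t + μ * t)
      ≤ Real.exp (μ ^ 2 / x) * Real.exp (-(x / 4) * t ^ 2) := by
  rw [← Real.exp_add]
  apply Real.exp_le_exp.2
  have h1 := mul_le_mul_of_nonneg_left (one_add_sq_div_two_le_cosh t) hx.le
  -- Half of the gain `x t²/2` absorbs the linear term by completing the square; the other half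
  -- remains as the Gaussian.
  have h2 : μ * t ≤ μ ^ 2 / x + x / 4 * t ^ 2 := by
    have : μ ^ 2 / x + x / 4 * t ^ 2 - μ * t = (μ - x * t / 2) ^ 2 / x := by
      field_simp; ring
    have h3 : 0 ≤ (μ - x * t / 2) ^ 2 / x := by positivity
    linarith
  nlinarith

theorem integrable_exp_cosh {x : ℝ} (hx : 0 < x) (μ : ℝ) :
    Integrable fun t : ℝ => Real.exp (-x * Real.cosh t + μ * t) := by
  refine Integrable.mono' ((integrable_exp_neg_mul_sq (b := x / 4) (by positivity)).const_mul
    (Real.exp (μ ^ 2 / x))) ?_ (ae_of_all _ fun t => ?_)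
  · exact (by fun_prop : Continuous fun t : ℝ =>
      Real.exp (-x * Real.cosh t + μ * t)).aestronglyMeasurable
  · rw [Real.norm_of_nonneg (Real.exp_pos _).le]
    exact exp_cosh_le_gaussian hx μ t

theorem besselK_integrand_eq (ν x t : ℝ) :
    Real.exp (-x * Real.cosh t) * Real.cosh (ν * t)
      = 1 / 2 * (Real.exp (-x * Real.cosh t + ν * t)
        + Real.exp (-x * Real.cosh (-t) + ν * (-t))) := by
  rw [Real.cosh_neg, Real.exp_add, Real.exp_add, Real.cosh_eq (ν * t), mul_neg]
  ring

/-- Splitting `cosh (νt)` into exponentials and reflecting one of them gives an integral over the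
whole line, where translation in `t` is available. -/
theorem besselK_eq_integral {x : ℝ} (hx : 0 < x) (ν : ℝ) :
    besselK ν x = 1 / 2 * ∫ t : ℝ, Real.exp (-x * Real.cosh t + ν * t) := by
  have hi := integrable_exp_cosh hx ν
  have hn : IntegrableOn (fun t : ℝ => Real.exp (-x * Real.cosh (-t) + ν * (-t))) (Ioi 0) :=
    hi.comp_neg.integrableOn
  unfold besselK
  simp_rw [besselK_integrand_eq]
  rw [integral_const_mul, integral_add hi.integrableOn hn,
    integral_comp_neg_Ioi 0 (fun t => Real.exp (-x * Real.cosh t + ν * t)), neg_zero, add_comm,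
    ← intervalIntegral.integral_Iic_add_Ioi hi.integrableOn hi.integrableOn]

theorem integrableOn_besselK_integrand {x : ℝ} (hx : 0 < x) (ν : ℝ) :
    IntegrableOn (fun t : ℝ => Real.exp (-x * Real.cosh t) * Real.cosh (ν * t)) (Ioi 0) := by
  simp_rw [besselK_integrand_eq]
  have hi := integrable_exp_cosh hx ν
  exact ((hi.add hi.comp_neg).const_mul _).integrableOn

theorem besselK_neg (ν x : ℝ) : besselK (-ν) x = besselK ν x := by
  simp [besselK]

theorem besselK_nonneg (ν x : ℝ) : 0 ≤ besselK ν x :=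
  integral_nonneg fun _ => mul_nonneg (Real.exp_pos _).le (Real.cosh_pos _).le

theorem besselK_pos {x : ℝ} (hx : 0 < x) (ν : ℝ) : 0 < besselK ν x := by
  rw [besselK_eq_integral hx]
  exact mul_pos (by norm_num) (integral_exp_pos (integrable_exp_cosh hx ν))

/-- Since `cosh t ≥ 1`, one has `-x cosh t ≤ (1 - x) - cosh t` for `x ≥ 1`. -/
theorem besselK_le_exp {x : ℝ} (hx : 1 ≤ x) (ν : ℝ) :
    besselK ν x ≤ Real.exp (1 - x) * besselK ν 1 := by
  unfold besselK
  rw [← integral_const_mul]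
  refine setIntegral_mono_on (integrableOn_besselK_integrand (by linarith) ν)
    ((integrableOn_besselK_integrand one_pos ν).const_mul _) measurableSet_Ioi fun t _ => ?_
  rw [← mul_assoc, ← Real.exp_add]
  refine mul_le_mul_of_nonneg_right (Real.exp_le_exp.2 ?_) (Real.cosh_pos _).le
  nlinarith [Real.one_le_cosh t]

theorem continuousOn_besselK (ν : ℝ) : ContinuousOn (besselK ν) (Ioi 0) := by
  intro x₀ hx₀
  have hx₀ : 0 < x₀ := hx₀
  refine ContinuousAt.continuousWithinAt ?_
  refine continuousAt_of_dominated
    (bound := fun t => Real.exp (-(x₀ / 2) * Real.cosh t) * Real.cosh (ν * t)) ?_ ?_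
    (integrableOn_besselK_integrand (by positivity) ν) ?_
  · exact Eventually.of_forall fun x =>
      (by fun_prop : Continuous fun t : ℝ =>
        Real.exp (-x * Real.cosh t) * Real.cosh (ν * t)).aestronglyMeasurable
  · filter_upwards [lt_mem_nhds (show x₀ / 2 < x₀ by linarith)] with x hx
    refine ae_of_all _ fun t => ?_
    rw [Real.norm_of_nonneg (mul_nonneg (Real.exp_pos _).le (Real.cosh_pos _).le)]
    refine mul_le_mul_of_nonneg_right (Real.exp_le_exp.2 ?_) (Real.cosh_pos _).le
    nlinarith [Real.cosh_pos t]
  · exact ae_of_all _ fun t => by fun_prop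

/-- The substitution `t = s - log x` in the integral representation of `K_μ`. -/
theorem rpow_mul_besselK {x : ℝ} (hx : 0 < x) (μ : ℝ) :
    x ^ μ * besselK μ x
      = 1 / 2 * ∫ s : ℝ, Real.exp (-(Real.exp s + x ^ 2 * Real.exp (-s)) / 2 + μ * s) := by
  rw [besselK_eq_integral hx, ← integral_sub_right_eq_self _ (Real.log x), mul_left_comm,
    ← integral_const_mul]
  congr 2
  ext s
  rw [Real.rpow_def_of_pos hx, ← Real.exp_add]
  congr 1
  rw [Real.cosh_eq, Real.exp_sub, Real.exp_log hx, neg_sub, Real.exp_sub, Real.exp_log hx,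
    Real.exp_neg]
  field_simp
  ring

/-- The substitution `y = e^s` turns this into Euler's Gamma integral. -/
theorem integral_exp_neg_exp {b p : ℝ} (hb : 0 < b) (hp : 0 < p) :
    Integrable (fun s : ℝ => Real.exp (-b * Real.exp s + p * s)) ∧
    ∫ s : ℝ, Real.exp (-b * Real.exp s + p * s) = b ^ (-p) * Real.Gamma p := by
  have himg : Real.exp '' univ = Ioi 0 := by rw [image_univ, Real.range_exp]
  have hd : ∀ s ∈ (univ : Set ℝ), HasDerivWithinAt Real.exp (Real.exp s) univ s :=
    fun s _ => (Real.hasDerivAt_exp s).hasDerivWithinAt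
  have key : ∀ s : ℝ, |Real.exp s| • (Real.exp s ^ (p - 1) * Real.exp (-b * Real.exp s))
      = Real.exp (-b * Real.exp s + p * s) := fun s => by
    rw [abs_of_pos (Real.exp_pos s), smul_eq_mul, ← Real.exp_mul, ← Real.exp_add, ← Real.exp_add]
    congr 1; ring
  have h1 := integrableOn_image_iff_integrableOn_abs_deriv_smul MeasurableSet.univ hd
    Real.exp_injective.injOn (fun y => y ^ (p - 1) * Real.exp (-b * y))
  have h2 := integral_image_eq_integral_abs_deriv_smul MeasurableSet.univ hd
    Real.exp_injective.injOn (fun y => y ^ (p - 1) * Real.exp (-b * y))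
  simp only [himg, key, Measure.restrict_univ, integrableOn_univ] at h1 h2
  constructor
  · apply h1.1
    simpa using integrableOn_rpow_mul_exp_neg_mul_rpow (p := 1) (s := p - 1) (by linarith) one_pos hb
  · rw [← h2]
    have := integral_rpow_mul_exp_neg_mul_rpow (p := 1) (q := p - 1) one_pos (by linarith) hb
    simpa using this

/-- `x^μ K_μ(x)` has a limit at `0+` when `μ > 0`. -/
theorem exists_tendsto_rpow_mul_besselK {μ : ℝ} (hμ : 0 < μ) :
    ∃ ℓ : ℝ, Tendsto (fun x => x ^ μ * besselK μ x) (𝓝[>] 0) (𝓝 ℓ) := by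
  -- The limit is the translated integral at `x = 0`, which converges because `μ > 0` and which
  -- dominates the integrals for all other `x`.
  refine ⟨1 / 2 * ∫ s : ℝ, Real.exp (-(Real.exp s + (0 : ℝ) ^ 2 * Real.exp (-s)) / 2 + μ * s), ?_⟩
  have hc : ContinuousAt (fun x : ℝ =>
      ∫ s : ℝ, Real.exp (-(Real.exp s + x ^ 2 * Real.exp (-s)) / 2 + μ * s)) 0 := by
    refine continuousAt_of_dominated
      (bound := fun s => Real.exp (-(1 / 2) * Real.exp s + μ * s)) ?_ ?_
      (integral_exp_neg_exp (by norm_num) hμ).1 ?_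
    · exact Eventually.of_forall fun x =>
        (by fun_prop : Continuous fun s : ℝ =>
          Real.exp (-(Real.exp s + x ^ 2 * Real.exp (-s)) / 2 + μ * s)).aestronglyMeasurable
    · refine Eventually.of_forall fun x => ae_of_all _ fun s => ?_
      rw [Real.norm_of_nonneg (Real.exp_pos _).le]
      refine Real.exp_le_exp.2 ?_
      have : 0 ≤ x ^ 2 * Real.exp (-s) := by positivity
      linarith
    · exact ae_of_all _ fun s => by fun_prop
  refine ((hc.tendsto.mono_left nhdsWithin_le_nhds).const_mul (1 / 2)).congr' ?_
  filter_upwards [self_mem_nhdsWithin] with x hx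
  rw [rpow_mul_besselK hx]

theorem tendsto_rpow_nhdsGT_zero {p : ℝ} (hp : 0 ≤ p) :
    ∃ ℓ : ℝ, Tendsto (fun x : ℝ => x ^ p) (𝓝[>] 0) (𝓝 ℓ) := by
  refine ⟨0 ^ p, (Real.continuousAt_rpow_const 0 p (Or.inr hp)).tendsto.mono_left
    nhdsWithin_le_nhds⟩

/-- This is the radial weight at `x = |z|^d`. After splitting off `x^{|ν|}`, which tames `K_ν =
K_{-ν}`, the remaining exponent is `2 - 2/d` for `ν > 0` and `2ν + 2 - 2/d` for `ν < 0`; both are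
nonnegative under `(*)`. -/
theorem exists_tendsto_rpow_mul_besselK_of_boundedAtOrigin {d : ℕ} (hd : 1 ≤ d) {ν : ℝ}
    (h : BoundedAtOrigin d ν) :
    ∃ ℓ : ℝ, Tendsto (fun x => x ^ (ν + 2 - 2 / (d : ℝ)) * besselK ν x) (𝓝[>] 0) (𝓝 ℓ) := by
  have hd0 : (0 : ℝ) < d := by exact_mod_cast hd
  have hd2 : 0 ≤ 2 - 2 / (d : ℝ) := by
    rw [sub_nonneg, div_le_iff₀ hd0]
    have : (1 : ℝ) ≤ d := by exact_mod_cast hd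
    linarith
  have main : ∀ μ p : ℝ, 0 < μ → 0 ≤ p → ∃ ℓ : ℝ,
      Tendsto (fun x => x ^ (p + μ) * besselK μ x) (𝓝[>] 0) (𝓝 ℓ) := by
    intro μ p hμ hp
    obtain ⟨ℓ₁, h1⟩ := exists_tendsto_rpow_mul_besselK hμ
    obtain ⟨ℓ₂, h2⟩ := tendsto_rpow_nhdsGT_zero hp
    refine ⟨ℓ₂ * ℓ₁, (h2.mul h1).congr' ?_⟩
    filter_upwards [self_mem_nhdsWithin] with x hx
    rw [Real.rpow_add hx]; ring
  rcases lt_trichotomy ν 0 with hν | hν | hν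
  · obtain h | ⟨_, h⟩ := h
    · exact absurd h hν.not_gt
    obtain ⟨ℓ, hl⟩ := main (-ν) (2 * ν + 2 - 2 / d) (by linarith) (by
      rw [div_le_iff₀ hd0] at h
      rw [sub_nonneg, div_le_iff₀ hd0]; linarith)
    refine ⟨ℓ, hl.congr fun x => ?_⟩
    rw [besselK_neg]; congr 2; ring
  · subst hν
    obtain h | ⟨h, _⟩ := h
    · exact absurd h (lt_irrefl _)
    have hd2' : 0 < 2 - 2 / (d : ℝ) := by
      rw [sub_pos, div_lt_iff₀ hd0]
      have : (2 : ℝ) ≤ d := by exact_mod_cast h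
      linarith
    -- For `ν = 0` compare `K_0 ≤ K_{q/2}`: half of the power `x^q` controls `K_{q/2}`, and the
    -- other half forces the limit `0`.
    set q := 2 - 2 / (d : ℝ) with hq
    obtain ⟨ℓ, hl⟩ := exists_tendsto_rpow_mul_besselK (half_pos hd2')
    have h0 : Tendsto (fun x : ℝ => x ^ (q / 2)) (𝓝[>] 0) (𝓝 0) := by
      have := (Real.continuousAt_rpow_const 0 (q / 2) (Or.inr (half_pos hd2').le)).tendsto
      rw [Real.zero_rpow (half_pos hd2').ne'] at this
      exact this.mono_left nhdsWithin_le_nhds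
    have h3 := h0.mul hl
    rw [zero_mul] at h3
    refine ⟨0, squeeze_zero' ?_ ?_ h3⟩
    · filter_upwards [self_mem_nhdsWithin] with x hx
      exact mul_nonneg (Real.rpow_nonneg (le_of_lt hx) _) (besselK_nonneg _ _)
    · filter_upwards [self_mem_nhdsWithin] with x hx
      have hx : 0 < x := hx
      rw [← mul_assoc, ← Real.rpow_add hx, add_halves, show (0 : ℝ) + 2 - 2 / d = q by rw [hq]; ring]
      refine mul_le_mul_of_nonneg_left ?_ (Real.rpow_nonneg hx.le _)
      refine setIntegral_mono_on (integrableOn_besselK_integrand hx _)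
        (integrableOn_besselK_integrand hx _) measurableSet_Ioi fun t _ => ?_
      refine mul_le_mul_of_nonneg_left ?_ (Real.exp_pos _).le
      rw [zero_mul, Real.cosh_zero]; exact Real.one_le_cosh _
  · obtain ⟨ℓ, hl⟩ := main ν (2 - 2 / d) hν hd2
    refine ⟨ℓ, hl.congr fun x => ?_⟩
    congr 2; ring

/-- Tonelli: in the translated integral the `t`-integration produces `Γ(n+ν+1)`, and the
`s`-integration then produces `n!`. With nonnegative integrals, integrability comes out as a result.
-/
theorem lintegral_rpow_mul_besselK {ν : ℝ} (hν : -1 < ν) (n : ℕ) :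
    ∫⁻ t in Ioi (0 : ℝ), ENNReal.ofReal (t ^ (2 * n + ν + 1) * besselK ν t)
      = ENNReal.ofReal (2 ^ (2 * n + ν) * n.factorial * Real.Gamma (n + ν + 1)) := by
  -- `t^{2n+ν+1} K_ν(t) = t^q · t^{-ν} K_{-ν}(t)`, so that `rpow_mul_besselK` applies with order
  -- `-ν`.
  set q : ℝ := 2 * n + 2 * ν + 1 with hq
  have hn : (0 : ℝ) ≤ n := n.cast_nonneg
  set f : ℝ → ℝ → ℝ := fun t s => 1 / 2 * (t ^ q *
    Real.exp (-(Real.exp s + t ^ 2 * Real.exp (-s)) / 2 + (-ν) * s)) with hf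
  have hmeas : Measurable (Function.uncurry f) := by
    simp only [hf, Function.uncurry_def]
    fun_prop
  have hint : ∀ t : ℝ, 0 < t → Integrable (fun s : ℝ =>
      Real.exp (-(Real.exp s + t ^ 2 * Real.exp (-s)) / 2 + (-ν) * s)) := by
    intro t ht
    have := (integrable_exp_cosh ht (-ν)).comp_sub_right (Real.log t)
    refine (this.const_mul (t ^ (-ν))).congr (ae_of_all _ fun s => ?_)
    simp only
    rw [Real.rpow_def_of_pos ht, ← Real.exp_add]
    congr 1
    rw [Real.cosh_eq, Real.exp_sub, Real.exp_log ht, neg_sub, Real.exp_sub, Real.exp_log ht,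
      Real.exp_neg]
    field_simp
    ring
  have h1 : ∀ t ∈ Ioi (0 : ℝ), ENNReal.ofReal (t ^ (2 * n + ν + 1) * besselK ν t)
      = ∫⁻ s : ℝ, ENNReal.ofReal (f t s) := by
    intro t ht
    have ht : 0 < t := ht
    rw [← ofReal_integral_eq_lintegral_ofReal (((hint t ht).const_mul _).const_mul _)
      (ae_of_all _ fun s => by
        have := Real.rpow_nonneg ht.le q
        simp only [Pi.zero_apply]; positivity), integral_const_mul, integral_const_mul,
      mul_left_comm, ← rpow_mul_besselK ht, besselK_neg, ← mul_assoc, ← Real.rpow_add ht]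
    congr 3; rw [hq]; ring
  rw [setLIntegral_congr_fun measurableSet_Ioi h1,
    lintegral_lintegral_swap hmeas.ennreal_ofReal.aemeasurable]
  have h2 : ∀ s : ℝ, ∫⁻ t in Ioi (0 : ℝ), ENNReal.ofReal (f t s)
      = ENNReal.ofReal (2 ^ (n + ν) / 2 * Real.Gamma (n + ν + 1) *
        Real.exp (-(1 / 2) * Real.exp s + (n + 1) * s)) := by
    intro s
    have hb : 0 < Real.exp (-s) / 2 := by positivity
    have hI := integrableOn_rpow_mul_exp_neg_mul_rpow (s := q) (p := 2) (by rw [hq]; linarith)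
      two_pos hb
    have he : ∀ t : ℝ, f t s = 1 / 2 * Real.exp (-(1 / 2) * Real.exp s + (-ν) * s) *
        (t ^ q * Real.exp (-(Real.exp (-s) / 2) * t ^ (2 : ℝ))) := by
      intro t
      rw [hf]; simp only
      rw [show -(Real.exp s + t ^ 2 * Real.exp (-s)) / 2 + (-ν) * s =
        (-(1 / 2) * Real.exp s + (-ν) * s) + (-(Real.exp (-s) / 2) * t ^ (2 : ℝ)) by
          rw [Real.rpow_two]; ring, Real.exp_add]
      ring
    simp_rw [he]
    rw [← ofReal_integral_eq_lintegral_ofReal (hI.const_mul _)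
      ((ae_restrict_iff' measurableSet_Ioi).2 (ae_of_all _ fun t ht => by
        have := Real.rpow_nonneg (le_of_lt ht) q
        simp only [Pi.zero_apply]; positivity)), integral_const_mul,
      integral_rpow_mul_exp_neg_mul_rpow two_pos (by rw [hq]; linarith) hb]
    congr 1
    have hq2 : (q + 1) / 2 = n + ν + 1 := by rw [hq]; ring
    rw [neg_div, hq2, Real.div_rpow (Real.exp_pos _).le two_pos.le, ← Real.exp_mul,
      Real.rpow_neg two_pos.le, div_inv_eq_mul, Real.rpow_add_one two_ne_zero,
      show -(1 / 2) * Real.exp s + (n + 1) * s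
        = (-(1 / 2) * Real.exp s + (-ν) * s) + (-s * -(n + ν + 1)) by ring,
      Real.exp_add _ (-s * -(n + ν + 1))]
    ring
  simp_rw [h2]
  have hp : (0 : ℝ) < n + 1 := by linarith
  obtain ⟨h3, h4⟩ := integral_exp_neg_exp (b := 1 / 2) (p := n + 1) (by norm_num) hp
  have hG : 0 < Real.Gamma (n + ν + 1) := Real.Gamma_pos_of_pos (by linarith)
  rw [← ofReal_integral_eq_lintegral_ofReal (h3.const_mul _) (ae_of_all _ fun s => by
      simp only [Pi.zero_apply]; positivity), integral_const_mul, h4, Real.Gamma_nat_eq_factorial]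
  congr 1
  rw [one_div, Real.inv_rpow two_pos.le, Real.rpow_neg two_pos.le, inv_inv,
    Real.rpow_add_one two_ne_zero, show (2 : ℝ) * n + ν = n + ν + n by ring,
    Real.rpow_add two_pos (n + ν)]
  ring

theorem integral_rpow_mul_besselK {ν : ℝ} (hν : -1 < ν) (n : ℕ) :
    IntegrableOn (fun t : ℝ => t ^ (2 * n + ν + 1) * besselK ν t) (Ioi 0) ∧
    ∫ t in Ioi (0 : ℝ), t ^ (2 * n + ν + 1) * besselK ν t
      = 2 ^ (2 * n + ν) * n.factorial * Real.Gamma (n + ν + 1) := by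
  have hn : (0 : ℝ) ≤ n := n.cast_nonneg
  have hm : AEStronglyMeasurable (fun t : ℝ => t ^ (2 * n + ν + 1) * besselK ν t)
      (volume.restrict (Ioi 0)) := by
    refine ContinuousOn.aestronglyMeasurable (ContinuousOn.mul ?_ (continuousOn_besselK ν))
      measurableSet_Ioi
    exact fun t ht => (Real.continuousAt_rpow_const t _ (Or.inl (ne_of_gt ht))).continuousWithinAt
  have h0 : ∀ᵐ t ∂(volume.restrict (Ioi (0 : ℝ))), 0 ≤ t ^ (2 * n + ν + 1) * besselK ν t :=
    (ae_restrict_iff' measurableSet_Ioi).2 (ae_of_all _ fun t ht =>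
      mul_nonneg (Real.rpow_nonneg (le_of_lt ht) _) (besselK_nonneg _ _))
  have hl := lintegral_rpow_mul_besselK hν n
  have hi : IntegrableOn (fun t : ℝ => t ^ (2 * n + ν + 1) * besselK ν t) (Ioi 0) := by
    refine ⟨hm, ?_⟩
    rw [hasFiniteIntegral_iff_ofReal h0, hl]
    exact ENNReal.ofReal_lt_top
  have hG : 0 < Real.Gamma (n + ν + 1) := Real.Gamma_pos_of_pos (by linarith)
  refine ⟨hi, ?_⟩
  rw [integral_eq_lintegral_of_nonneg_ae h0 hm, hl, ENNReal.toReal_ofReal (by positivity)]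

/-! ### Exponential moments and the orthogonality of Laguerre polynomials in the plane. -/

/-- The exponential integrability and the moments of the image of the weight
`(d/2^{ν+1}) A K_ν(|v|)|v|^ν`. -/
structure BesselMoments (m : Measure ℂ) (A ν : ℝ) : Prop where
  integrable_exp : ∀ b : ℝ, b < 1 → Integrable (fun v : ℂ => Real.exp (b * ‖v‖)) m
  moment : ∀ j k : ℕ, ∫ v : ℂ, v ^ j * conj v ^ k ∂m
    = if j = k then ((A * 4 ^ j * j.factorial * Real.Gamma (j + ν + 1) : ℝ) : ℂ) else 0

theorem Gamma_add_nat_eq_ascPochhammer {x : ℝ} (hx : 0 < x) (n : ℕ) :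
    Real.Gamma (x + n) = (ascPochhammer ℝ n).eval x * Real.Gamma x := by
  induction n with
  | zero => simp
  | succ n ih =>
    have : x + n ≠ 0 := by positivity
    rw [ascPochhammer_succ_eval, Nat.cast_succ, ← add_assoc, Real.Gamma_add_one this, ih]
    ring

/-- The negative binomial series: `Γ(n+ν+1)/Γ(ν+1)` is the rising factorial of `ν+1`. -/
theorem hasSum_Gamma_mul_pow {ν x : ℝ} (hν : -1 < ν) (hx : |x| < 1) :
    HasSum (fun n : ℕ => Real.Gamma (n + ν + 1) / n.factorial * x ^ n)
      (Real.Gamma (ν + 1) * (1 - x) ^ (-(ν + 1))) := by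
  have hs := (Real.one_div_one_sub_rpow_hasFPowerSeriesOnBall_zero (ν + 1)).hasSum
    (y := x) (by simpa [enorm_eq_nnnorm, ← NNReal.coe_lt_one] using! hx)
  have h1 : 0 ≤ 1 - x := by linarith [(abs_lt.1 hx).2]
  simp only [zero_add, FormalMultilinearSeries.ofScalars_apply_eq, smul_eq_mul] at hs
  rw [one_div, ← Real.rpow_neg h1] at hs
  refine (hs.mul_left (Real.Gamma (ν + 1))).congr_fun ?_
  intro n
  rw [show (n : ℝ) + ν + 1 = ν + 1 + n by ring, Gamma_add_nat_eq_ascPochhammer (by linarith),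
    Ring.choose_eq_smul, Polynomial.descPochhammer_smeval_eq_ascPochhammer,
    Polynomial.ascPochhammer_smeval_cast, Polynomial.ascPochhammer_smeval_eq_eval,
    show ν + 1 + n - 1 - n + 1 = ν + 1 by ring, smul_eq_mul]
  field_simp

/-- Half of the slack `1 - b` absorbs the power, and the new rate `(1+b)/2` is still below `1`. -/
theorem pow_mul_exp_le {b r : ℝ} (hb : b < 1) (hr : 0 ≤ r) (k : ℕ) :
    r ^ k * Real.exp (b * r)
      ≤ k.factorial / ((1 - b) / 2) ^ k * Real.exp ((1 + b) / 2 * r) := by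
  have hδ : 0 < (1 - b) / 2 := by linarith
  have h := Real.pow_div_factorial_le_exp ((1 - b) / 2 * r) (by positivity) k
  rw [show (1 + b) / 2 * r = (1 - b) / 2 * r + b * r by ring, Real.exp_add, ← mul_assoc]
  refine mul_le_mul_of_nonneg_right ?_ (Real.exp_pos _).le
  calc r ^ k = k.factorial / ((1 - b) / 2) ^ k * (((1 - b) / 2 * r) ^ k / k.factorial) := by
        rw [mul_pow]; field_simp
    _ ≤ _ := by gcongr

namespace BesselMoments
variable {m : Measure ℂ} {A ν : ℝ}

theorem integrable_pow_mul_exp (H : BesselMoments m A ν) {b : ℝ} (hb : b < 1) (k : ℕ) :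
    Integrable (fun v : ℂ => ‖v‖ ^ k * Real.exp (b * ‖v‖)) m := by
  refine Integrable.mono' ((H.integrable_exp ((1 + b) / 2) (by linarith)).const_mul
    (k.factorial / ((1 - b) / 2) ^ k)) (by fun_prop) (ae_of_all _ fun v => ?_)
  rw [Real.norm_of_nonneg (by positivity)]
  exact pow_mul_exp_le hb (norm_nonneg v) k

end BesselMoments

theorem norm_exp_add_conj_le (α β : ℝ) (v : ℂ) :
    ‖Complex.exp (α * v + β * conj v)‖ ≤ Real.exp ((|α| + |β|) * ‖v‖) := by
  refine (Complex.norm_exp_le_exp_norm _).trans (Real.exp_le_exp.2 ?_)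
  refine (norm_add_le _ _).trans ?_
  simp [add_mul]

/-- The joint exponential moments `∫ v^j v̄^k e^{αv + βv̄}`. -/
noncomputable def expMoment (m : Measure ℂ) (j k : ℕ) (α β : ℝ) : ℂ :=
  ∫ v : ℂ, v ^ j * conj v ^ k * Complex.exp (α * v + β * conj v) ∂m

namespace BesselMoments
variable {m : Measure ℂ} {A ν : ℝ}

theorem integrable_expMoment (H : BesselMoments m A ν) {α β : ℝ} (h : |α| + |β| < 1) (j k : ℕ) :
    Integrable (fun v : ℂ => v ^ j * conj v ^ k * Complex.exp (α * v + β * conj v)) m := by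
  refine Integrable.mono' (H.integrable_pow_mul_exp h (j + k)) (by fun_prop)
    (ae_of_all _ fun v => ?_)
  rw [norm_mul, norm_mul, norm_pow, norm_pow, RCLike.norm_conj, ← pow_add]
  exact mul_le_mul_of_nonneg_left (norm_exp_add_conj_le α β v) (by positivity)

/-- Expand both exponentials and integrate termwise: only the diagonal moments survive, and they sum
to the negative binomial series at `4αβ`. -/
theorem expMoment_zero_zero (H : BesselMoments m A ν) (hν : -1 < ν) {α β : ℝ}
    (h : |α| + |β| < 1) :
    expMoment m 0 0 α β
      = ((A * Real.Gamma (ν + 1) * (1 - 4 * (α * β)) ^ (-(ν + 1)) : ℝ) : ℂ) := by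
  set F : ℕ × ℕ → ℂ → ℂ := fun p v => (α * v) ^ p.1 / p.1.factorial *
    ((β * conj v) ^ p.2 / p.2.factorial) with hF
  have hFn : ∀ p v, ‖F p v‖ = (|α| * ‖v‖) ^ p.1 / p.1.factorial *
      ((|β| * ‖v‖) ^ p.2 / p.2.factorial) := by
    intro p v
    simp [hF]
  have hFm : ∀ p, Continuous (F p) := fun p => by
    simp only [hF]
    fun_prop
  have hexpsum : ∀ z : ℂ, Summable fun n : ℕ => ‖z ^ n / n.factorial‖ := fun z =>
    NormedSpace.norm_expSeries_div_summable z
  have hsum_le : ∀ (s : Finset (ℕ × ℕ)) (v : ℂ),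
      ∑ p ∈ s, ‖F p v‖ ≤ Real.exp ((|α| + |β|) * ‖v‖) := by
    intro s v
    have h1 := NormedSpace.expSeries_div_hasSum_exp (𝔸 := ℝ) (|α| * ‖v‖)
    have h2 := NormedSpace.expSeries_div_hasSum_exp (𝔸 := ℝ) (|β| * ‖v‖)
    rw [← Real.exp_eq_exp_ℝ] at h1 h2
    have h3 := h1.mul h2 (summable_mul_of_summable_norm h1.summable.norm h2.summable.norm)
    rw [add_mul, Real.exp_add]
    refine le_trans (le_of_eq ?_) (sum_le_hasSum s (fun p _ => by positivity) h3)
    exact Finset.sum_congr rfl fun p _ => hFn p v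
  have hFi : ∀ p, Integrable (F p) m := fun p =>
    Integrable.mono' (H.integrable_exp _ h) (hFm p).aestronglyMeasurable
      (ae_of_all _ fun v => by simpa using hsum_le {p} v)
  -- Every finite sum of the norms lies below the single integrable function `e^{(|α|+|β|)|v|}`,
  -- which justifies the interchange.
  have hsummable : Summable fun p => ∫ v, ‖F p v‖ ∂m := by
    refine summable_of_sum_le (c := ∫ v, Real.exp ((|α| + |β|) * ‖v‖) ∂m)
      (fun p => integral_nonneg fun _ => norm_nonneg _) fun s => ?_
    rw [← integral_finsetSum _ fun p _ => (hFi p).norm]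
    exact integral_mono (integrable_finsetSum _ fun p _ => (hFi p).norm)
      (H.integrable_exp _ h) (hsum_le s)
  have key := hasSum_integral_of_summable_integral_norm hFi hsummable
  have hts : ∀ v : ℂ, ∑' p, F p v = Complex.exp (α * v + β * conj v) := by
    intro v
    rw [Complex.exp_add, Complex.exp_eq_exp_ℂ, ← (NormedSpace.expSeries_div_hasSum_exp (𝔸 := ℂ) (α * v)).tsum_eq,
      ← (NormedSpace.expSeries_div_hasSum_exp (𝔸 := ℂ) (β * conj v)).tsum_eq,
      tsum_mul_tsum_of_summable_norm (hexpsum _) (hexpsum _)]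
  simp_rw [hts] at key
  have hmom : ∀ p : ℕ × ℕ, ∫ v, F p v ∂m = (α : ℂ) ^ p.1 * β ^ p.2 / (p.1.factorial * p.2.factorial)
      * (if p.1 = p.2 then ((A * 4 ^ p.1 * p.1.factorial * Real.Gamma (p.1 + ν + 1) : ℝ) : ℂ)
        else 0) := by
    intro p
    rw [← H.moment, ← integral_const_mul]
    congr 1; ext v
    simp only [hF, mul_pow]
    ring
  simp_rw [hmom] at key
  have hinj : Function.Injective fun n : ℕ => (n, n) := fun a b hab => (Prod.ext_iff.1 hab).1
  rw [← hinj.hasSum_iff (by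
    rintro ⟨a, b⟩ hab
    rw [if_neg, mul_zero]
    rintro (rfl : a = b)
    exact hab ⟨a, rfl⟩)] at key
  -- `4|α||β| ≤ (|α|+|β|)² < 1`.
  have hx : |4 * (α * β)| < 1 := by
    rw [abs_mul, abs_mul, abs_of_pos (by norm_num : (0 : ℝ) < 4)]
    nlinarith [sq_nonneg (|α| - |β|), abs_nonneg α, abs_nonneg β]
  have hb := (hasSum_Gamma_mul_pow hν hx).mul_left A
  have hb' := Complex.hasSum_ofReal.2 hb
  have : expMoment m 0 0 α β = ∫ v, Complex.exp (α * v + β * conj v) ∂m := by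
    simp [expMoment]
  rw [this]
  refine (key.unique (hb'.congr_fun fun n => ?_)).trans (by rw [mul_assoc])
  have hn : (n.factorial : ℂ) ≠ 0 := by exact_mod_cast n.factorial_ne_zero
  simp only [Function.comp, if_true]
  push_cast
  field_simp
  ring

/-- Stated for a general `u` so as to cover both `u = v` and `u = v̄`. The radius `δ` is half the
slack, so the dominating exponential rate stays below `1`. -/
theorem hasDerivAt_integral_exp (H : BesselMoments m A ν) {g u : ℂ → ℂ} (hg : Continuous g)
    (hu : Continuous u) {k : ℕ} {a t₀ : ℝ} (hgb : ∀ v, ‖g v‖ ≤ ‖v‖ ^ k * Real.exp (a * ‖v‖))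
    (hub : ∀ v, ‖u v‖ = ‖v‖) (h : a + |t₀| < 1) :
    HasDerivAt (fun t : ℝ => ∫ v, g v * Complex.exp (t * u v) ∂m)
      (∫ v, g v * (u v * Complex.exp (t₀ * u v)) ∂m) t₀ := by
  set δ := (1 - (a + |t₀|)) / 2 with hδ
  have hδ0 : 0 < δ := by rw [hδ]; linarith
  have hbound : ∀ (t : ℝ), |t| ≤ |t₀| + δ → ∀ v,
      ‖g v * Complex.exp (t * u v)‖ ≤ ‖v‖ ^ k * Real.exp ((a + |t₀| + δ) * ‖v‖) := by
    intro t ht v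
    rw [norm_mul, add_assoc, add_mul, Real.exp_add, ← mul_assoc]
    refine mul_le_mul (hgb v) ?_ (norm_nonneg _) (by positivity)
    refine (Complex.norm_exp_le_exp_norm _).trans (Real.exp_le_exp.2 ?_)
    rw [norm_mul, hub, Complex.norm_real]
    exact mul_le_mul_of_nonneg_right ht (norm_nonneg v)
  have hlt : a + |t₀| + δ < 1 := by rw [hδ]; linarith
  refine (hasDerivAt_integral_of_dominated_loc_of_deriv_le (s := Metric.ball t₀ δ)
    (F := fun (t : ℝ) (v : ℂ) => g v * Complex.exp (t * u v))
    (F' := fun (t : ℝ) (v : ℂ) => g v * (u v * Complex.exp (t * u v)))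
    (bound := fun v => ‖v‖ ^ (k + 1) * Real.exp ((a + |t₀| + δ) * ‖v‖)) (Metric.ball_mem_nhds _ hδ0)
    (Eventually.of_forall fun t => (by fun_prop : Continuous fun v =>
      g v * Complex.exp (t * u v)).aestronglyMeasurable) ?_
    (by fun_prop : Continuous fun v =>
      g v * (u v * Complex.exp (t₀ * u v))).aestronglyMeasurable ?_
    (H.integrable_pow_mul_exp hlt (k + 1)) ?_).2
  · exact Integrable.mono' (H.integrable_pow_mul_exp hlt k)
      (by fun_prop : Continuous fun v => g v * Complex.exp (t₀ * u v)).aestronglyMeasurable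
      (ae_of_all _ (hbound t₀ (by linarith)))
  · refine ae_of_all _ fun v t ht => ?_
    have ht' : |t| ≤ |t₀| + δ := by
      have := abs_sub_abs_le_abs_sub t t₀
      have h2 : |t - t₀| < δ := ht
      linarith
    rw [mul_left_comm, norm_mul, hub, pow_succ', mul_assoc]
    exact mul_le_mul_of_nonneg_left (hbound t ht' v) (norm_nonneg v)
  · refine ae_of_all _ fun v t _ => ?_
    have h1 : HasDerivAt (fun t : ℝ => (t : ℂ) * u v) (u v) t := by
      simpa using (Complex.ofRealCLM.hasDerivAt (x := t)).mul_const (u v)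
    simpa [mul_comm] using (h1.cexp).const_mul (g v)

theorem norm_pow_mul_exp_le (j k : ℕ) (b : ℝ) {u : ℂ → ℂ} (hub : ∀ v, ‖u v‖ = ‖v‖) (v : ℂ) :
    ‖v ^ j * conj v ^ k * Complex.exp (b * u v)‖ ≤ ‖v‖ ^ (j + k) * Real.exp (|b| * ‖v‖) := by
  rw [norm_mul, norm_mul, norm_pow, norm_pow, RCLike.norm_conj, ← pow_add]
  refine mul_le_mul_of_nonneg_left ((Complex.norm_exp_le_exp_norm _).trans
    (Real.exp_le_exp.2 ?_)) (by positivity)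
  rw [norm_mul, hub, Complex.norm_real, Real.norm_eq_abs]

theorem hasDerivAt_expMoment_left (H : BesselMoments m A ν) {α β : ℝ} (h : |α| + |β| < 1)
    (j k : ℕ) :
    HasDerivAt (fun a : ℝ => expMoment m j k a β) (expMoment m (j + 1) k α β) α := by
  have := H.hasDerivAt_integral_exp (g := fun v => v ^ j * conj v ^ k * Complex.exp (β * conj v))
    (u := fun v => v) (by fun_prop) (by fun_prop)
    (norm_pow_mul_exp_le j k β (u := fun v => conj v) (fun v => RCLike.norm_conj v))
    (fun _ => rfl) (t₀ := α) (by linarith)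
  refine (this.congr_deriv ?_).congr_of_eventuallyEq (Eventually.of_forall fun a => ?_)
  all_goals
    simp only [expMoment]
    congr 1; ext v
    rw [Complex.exp_add]; ring

theorem hasDerivAt_expMoment_right (H : BesselMoments m A ν) {α β : ℝ} (h : |α| + |β| < 1)
    (j k : ℕ) :
    HasDerivAt (fun b : ℝ => expMoment m j k α b) (expMoment m j (k + 1) α β) β := by
  have := H.hasDerivAt_integral_exp (g := fun v => v ^ j * conj v ^ k * Complex.exp (α * v))
    (u := fun v => conj v) (by fun_prop) (by fun_prop)
    (norm_pow_mul_exp_le j k α (u := fun v => v) (fun v => rfl))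
    (fun v => RCLike.norm_conj v) (t₀ := β) (by linarith)
  refine (this.congr_deriv ?_).congr_of_eventuallyEq (Eventually.of_forall fun a => ?_)
  all_goals
    simp only [expMoment]
    congr 1; ext v
    rw [Complex.exp_add]; ring

theorem one_sub_four_mul_pos {α β : ℝ} (h : |α| + |β| < 1) : 0 < 1 - 4 * (α * β) := by
  have h1 : α * β ≤ |α| * |β| := by rw [← abs_mul]; exact le_abs_self _
  nlinarith [sq_nonneg (|α| - |β|), abs_nonneg α, abs_nonneg β]

/-- Each `α`-derivative of the closed form brings down `4β(ν+1+j)`, and the functional equation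
absorbs `ν+1+j` into Gamma. -/
theorem expMoment_right_zero (H : BesselMoments m A ν) (hν : -1 < ν) (j : ℕ) :
    ∀ {α β : ℝ}, |α| + |β| < 1 → expMoment m j 0 α β
      = ((A * Real.Gamma (ν + 1 + j) * (4 * β) ^ j *
        (1 - 4 * (α * β)) ^ (-(ν + 1 + j)) : ℝ) : ℂ) := by
  induction j with
  | zero => intro α β h; simpa using H.expMoment_zero_zero hν h
  | succ j ih =>
    intro α β h
    have hd := H.hasDerivAt_expMoment_left h j 0
    have hpos := one_sub_four_mul_pos h
    have hev : ∀ᶠ a in 𝓝 α, |a| + |β| < 1 := by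
      have : Continuous fun a : ℝ => |a| + |β| := by fun_prop
      exact this.continuousAt.eventually_lt_const h
    have hlin : HasDerivAt (fun a : ℝ => 1 - 4 * (a * β)) (-(4 * β)) α := by
      simpa using (((hasDerivAt_id α).mul_const β).const_mul 4).const_sub 1
    have hd2 := ((hlin.rpow_const (p := -(ν + 1 + j)) (Or.inl hpos.ne')).const_mul
      (A * Real.Gamma (ν + 1 + j) * (4 * β) ^ j)).ofReal_comp
    rw [hd.unique (hd2.congr_of_eventuallyEq (hev.mono fun a ha => ih ha))]
    have hne : ν + 1 + j ≠ 0 := by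
      have : (0 : ℝ) ≤ j := j.cast_nonneg
      linarith
    congr 1
    rw [Nat.cast_succ, ← add_assoc, Real.Gamma_add_one hne, pow_succ,
      show -(ν + 1 + (j : ℝ) + 1) = -(ν + 1 + j) - 1 by ring]
    ring

end BesselMoments

/-- The coefficients of the normalized Laguerre polynomial
`n!/Γ(n+ν+1) L_n^ν(C x) = ∑_j (-C)^j binom(n,j) x^j / Γ(ν+j+1)`. -/
noncomputable def laguerreCoeff (ν C : ℝ) (n j : ℕ) : ℝ :=
  (-C) ^ j * n.choose j / Real.Gamma (ν + 1 + j)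

/-- The polynomial `n!/Γ(n+ν+1) L_n^ν(C x)`. -/
noncomputable def laguerrePoly (ν C : ℝ) (n : ℕ) (v : ℂ) : ℂ :=
  ∑ j ∈ Finset.range (n + 1), (laguerreCoeff ν C n j : ℂ) * v ^ j

theorem continuous_laguerrePoly (ν C : ℝ) (n : ℕ) : Continuous (laguerrePoly ν C n) := by
  unfold laguerrePoly; fun_prop

/-- The squared norm of `laguerrePoly`. -/
noncomputable def laguerreNorm (A ν τ : ℝ) (n : ℕ) : ℝ :=
  A * n.factorial / Real.Gamma (ν + 1 + n) * (τ ^ (2 * n))⁻¹ * (1 - τ ^ 2) ^ (-(ν + 1))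

namespace BesselMoments
variable {m : Measure ℂ} {A ν : ℝ}

/-- `∫ p_n(v) v̄^k e^{αv + βv̄}`. -/
noncomputable def laguerreMoment (m : Measure ℂ) (ν C : ℝ) (n k : ℕ) (α β : ℝ) : ℂ :=
  ∑ j ∈ Finset.range (n + 1), (laguerreCoeff ν C n j : ℂ) * expMoment m j k α β

/-- The Gamma factors of the moments cancel those in the Laguerre coefficients. What remains is the
binomial expansion of `((1 - 4αβ) - 4Cβ)^n`. -/
theorem laguerreMoment_zero (H : BesselMoments m A ν) (hν : -1 < ν) (C : ℝ) (n : ℕ) {α β : ℝ}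
    (h : |α| + |β| < 1) :
    laguerreMoment m ν C n 0 α β
      = ((A * (1 - 4 * (α * β)) ^ (-(ν + 1 + n)) * (1 - 4 * (α + C) * β) ^ n : ℝ) : ℂ) := by
  unfold laguerreMoment
  simp_rw [H.expMoment_right_zero hν _ h, ← Complex.ofReal_mul, ← Complex.ofReal_sum]
  congr 1
  set x := 1 - 4 * (α * β) with hx
  have hx0 : 0 < x := one_sub_four_mul_pos h
  have h2 : (1 - 4 * (α + C) * β) = -(4 * C * β) + x := by rw [hx]; ring
  rw [h2, add_pow, Finset.mul_sum]
  refine Finset.sum_congr rfl fun j hj => ?_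
  have hj : j ≤ n := by simpa [Nat.lt_succ_iff] using hj
  have hG : Real.Gamma (ν + 1 + j) ≠ 0 := (Real.Gamma_pos_of_pos (by
    have : (0 : ℝ) ≤ j := j.cast_nonneg
    linarith)).ne'
  have hp : x ^ (-(ν + 1 + (j : ℝ))) = x ^ (-(ν + 1 + n)) * x ^ (n - j) := by
    rw [← Real.rpow_natCast, ← Real.rpow_add hx0, Nat.cast_sub hj]
    congr 1; ring
  have hc : (-(4 * C * β)) ^ j = (-C) ^ j * (4 * β) ^ j := by rw [← mul_pow]; congr 1; ring
  rw [hp, hc, laguerreCoeff]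
  field_simp

theorem hasDerivAt_laguerreMoment (H : BesselMoments m A ν) (C : ℝ) (n k : ℕ) {α β : ℝ}
    (h : |α| + |β| < 1) :
    HasDerivAt (fun b : ℝ => laguerreMoment m ν C n k α b) (laguerreMoment m ν C n (k + 1) α β) β := by
  unfold laguerreMoment
  exact HasDerivAt.fun_sum fun j _ => (H.hasDerivAt_expMoment_right h j k).const_mul _

/-- For this `C` one has `τ/2 + C = 1/(2τ)`, so the moment with `k = 0` contains `(1 - 2β/τ)^n`.
Each `β`-derivative inserts a factor `v̄` and lowers the order of this zero by one; `g` is the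
smooth cofactor, and its value at `τ/2` determines the norm. -/
theorem laguerreMoment_eq (H : BesselMoments m A ν) (hν : -1 < ν) {τ : ℝ} (hτ0 : 0 < τ)
    (hτ1 : τ < 1) (n : ℕ) {k : ℕ} (hk : k ≤ n) :
    ∃ g : ℝ → ℝ, ContDiffOn ℝ (⊤ : ℕ∞) g (Ioo (-(1 - τ / 2)) (1 - τ / 2)) ∧
      (∀ β ∈ Ioo (-(1 - τ / 2)) (1 - τ / 2),
        laguerreMoment m ν ((1 - τ ^ 2) / (2 * τ)) n k (τ / 2) β
          = (((1 - 2 * β / τ) ^ (n - k) * g β : ℝ) : ℂ)) ∧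
      g (τ / 2) = (-2 / τ) ^ k * n.descFactorial k * (A * (1 - τ ^ 2) ^ (-(ν + 1 + n))) := by
  set U := Ioo (-(1 - τ / 2)) (1 - τ / 2) with hU
  have hUo : IsOpen U := isOpen_Ioo
  have hmem : ∀ β ∈ U, |τ / 2| + |β| < 1 := fun β hβ => by
    have := abs_lt.2 hβ
    rw [abs_of_pos (half_pos hτ0)]; linarith
  have hτU : τ / 2 ∈ U := ⟨by linarith, by linarith⟩
  induction k with
  | zero =>
    refine ⟨fun β => A * (1 - 4 * (τ / 2 * β)) ^ (-(ν + 1 + n)), ?_, fun β hβ => ?_, ?_⟩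
    · intro β hβ
      have := one_sub_four_mul_pos (hmem β hβ)
      refine ContDiffAt.contDiffWithinAt (contDiffAt_const.mul
        (ContDiffAt.rpow_const_of_ne (by fun_prop) this.ne'))
    · rw [H.laguerreMoment_zero hν _ _ (hmem β hβ)]
      congr 1
      have : 1 - 4 * (τ / 2 + (1 - τ ^ 2) / (2 * τ)) * β = 1 - 2 * β / τ := by
        field_simp; ring
      rw [this, Nat.sub_zero]; ring
    · simp only [pow_zero, Nat.descFactorial_zero, Nat.cast_one, one_mul]
      congr 3; ring
  | succ k ih =>
    obtain ⟨g, hg, hgeq, hgv⟩ := ih (Nat.le_of_succ_le hk)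
    obtain ⟨r, rfl⟩ := Nat.exists_eq_add_of_le hk
    have e1 : k + 1 + r - k = r + 1 := by omega
    have e2 : k + 1 + r - (k + 1) = r := by omega
    rw [e1] at hgeq
    rw [e2]
    have hg1 : ContDiffOn ℝ (⊤ : ℕ∞) (deriv g) U := hg.deriv_of_isOpen hUo (by simp)
    -- The product rule for `(1 - 2β/τ)^{r+1} g(β)`, with `(1 - 2β/τ)^r` factored out.
    refine ⟨fun β => (r + 1) * (-2 / τ) * g β + (1 - 2 * β / τ) * deriv g β, ?_, fun β hβ => ?_, ?_⟩
    · exact (contDiffOn_const.mul hg).add (ContDiffOn.mul (by fun_prop) hg1)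
    · have hgd : HasDerivAt g (deriv g β) β :=
        ((hg.contDiffAt (hUo.mem_nhds hβ)).differentiableAt (by simp)).hasDerivAt
      have hl : HasDerivAt (fun b : ℝ => 1 - 2 * b / τ) (-2 / τ) β := by
        have := (((hasDerivAt_id β).const_mul 2).div_const τ).const_sub 1
        simpa [neg_div] using this
      have hd := H.hasDerivAt_laguerreMoment ((1 - τ ^ 2) / (2 * τ)) (k + 1 + r) k (hmem β hβ)
      have hd2 := ((hl.fun_pow (r + 1)).mul hgd).ofReal_comp
      rw [hd.unique (hd2.congr_of_eventuallyEq
        ((hUo.eventually_mem hβ).mono fun b hb => hgeq b hb))]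
      congr 1
      rw [Nat.add_sub_cancel]
      push_cast
      ring
    · simp only
      rw [hgv, show 1 - 2 * (τ / 2) / τ = 0 by field_simp; ring, zero_mul, add_zero,
        Nat.descFactorial_succ, show k + 1 + r - k = r + 1 by omega, pow_succ]
      push_cast
      ring

theorem laguerreMoment_of_lt (H : BesselMoments m A ν) (hν : -1 < ν) {τ : ℝ} (hτ0 : 0 < τ)
    (hτ1 : τ < 1) {n k : ℕ} (hk : k < n) :
    laguerreMoment m ν ((1 - τ ^ 2) / (2 * τ)) n k (τ / 2) (τ / 2) = 0 := by
  obtain ⟨g, -, h, -⟩ := H.laguerreMoment_eq hν hτ0 hτ1 n hk.le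
  rw [h _ ⟨by linarith, by linarith⟩, show 1 - 2 * (τ / 2) / τ = 0 by field_simp; ring,
    zero_pow (by omega), zero_mul, Complex.ofReal_zero]

theorem laguerreMoment_self (H : BesselMoments m A ν) (hν : -1 < ν) {τ : ℝ} (hτ0 : 0 < τ)
    (hτ1 : τ < 1) (n : ℕ) :
    laguerreMoment m ν ((1 - τ ^ 2) / (2 * τ)) n n (τ / 2) (τ / 2)
      = (((-2 / τ) ^ n * n.factorial * (A * (1 - τ ^ 2) ^ (-(ν + 1 + n))) : ℝ) : ℂ) := by
  obtain ⟨g, -, h, h'⟩ := H.laguerreMoment_eq hν hτ0 hτ1 n le_rfl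
  rw [h _ ⟨by linarith, by linarith⟩, h', Nat.sub_self, pow_zero, one_mul,
    Nat.descFactorial_self]

theorem exp_mul_re (τ : ℝ) (v : ℂ) :
    (Real.exp (τ * v.re) : ℂ) = Complex.exp ((τ / 2 : ℝ) * v + (τ / 2 : ℝ) * conj v) := by
  rw [Complex.ofReal_exp, ← mul_add, Complex.add_conj]
  push_cast
  congr 1; ring

theorem integral_laguerrePoly_mul_pow (H : BesselMoments m A ν) {τ : ℝ} (hτ0 : 0 < τ)
    (hτ1 : τ < 1) (C : ℝ) (n k : ℕ) :
    Integrable (fun v => laguerrePoly ν C n v * conj v ^ k * (Real.exp (τ * v.re) : ℂ)) m ∧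
    ∫ v, laguerrePoly ν C n v * conj v ^ k * (Real.exp (τ * v.re) : ℂ) ∂m
      = laguerreMoment m ν C n k (τ / 2) (τ / 2) := by
  have hlt : |τ / 2| + |τ / 2| < 1 := by rw [abs_of_pos (half_pos hτ0)]; linarith
  have he : ∀ v : ℂ, laguerrePoly ν C n v * conj v ^ k * (Real.exp (τ * v.re) : ℂ)
      = ∑ j ∈ Finset.range (n + 1), (laguerreCoeff ν C n j : ℂ) *
        (v ^ j * conj v ^ k * Complex.exp ((τ / 2 : ℝ) * v + (τ / 2 : ℝ) * conj v)) := by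
    intro v
    rw [exp_mul_re, laguerrePoly, Finset.sum_mul, Finset.sum_mul]
    refine Finset.sum_congr rfl fun j _ => by ring
  simp_rw [he]
  have hi := fun j => (H.integrable_expMoment hlt j k).const_mul (laguerreCoeff ν C n j : ℂ)
  refine ⟨integrable_finsetSum _ fun j _ => hi j, ?_⟩
  rw [integral_finsetSum _ fun j _ => hi j]
  simp_rw [integral_const_mul]
  rfl

theorem integral_laguerrePoly_mul_conj (H : BesselMoments m A ν) {τ : ℝ} (hτ0 : 0 < τ)
    (hτ1 : τ < 1) (C : ℝ) (n k : ℕ) :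
    Integrable (fun v => laguerrePoly ν C n v * conj (laguerrePoly ν C k v) *
      (Real.exp (τ * v.re) : ℂ)) m ∧
    ∫ v, laguerrePoly ν C n v * conj (laguerrePoly ν C k v) * (Real.exp (τ * v.re) : ℂ) ∂m
      = ∑ j ∈ Finset.range (k + 1),
        (laguerreCoeff ν C k j : ℂ) * laguerreMoment m ν C n j (τ / 2) (τ / 2) := by
  have he : ∀ v : ℂ, laguerrePoly ν C n v * conj (laguerrePoly ν C k v) *
      (Real.exp (τ * v.re) : ℂ) = ∑ j ∈ Finset.range (k + 1), (laguerreCoeff ν C k j : ℂ) *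
        (laguerrePoly ν C n v * conj v ^ j * (Real.exp (τ * v.re) : ℂ)) := by
    intro v
    conv_lhs => rw [laguerrePoly.eq_1 ν C k]
    simp only [map_sum, map_mul, map_pow, Complex.conj_ofReal, Finset.mul_sum, Finset.sum_mul]
    refine Finset.sum_congr rfl fun j _ => by ring
  simp_rw [he]
  have hi := fun j => (H.integral_laguerrePoly_mul_pow hτ0 hτ1 C n j).1.const_mul
    (laguerreCoeff ν C k j : ℂ)
  refine ⟨integrable_finsetSum _ fun j _ => hi j, ?_⟩
  rw [integral_finsetSum _ fun j _ => hi j]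
  simp_rw [integral_const_mul, (H.integral_laguerrePoly_mul_pow hτ0 hτ1 C n _).2]

theorem integral_laguerrePoly_of_lt (H : BesselMoments m A ν) (hν : -1 < ν) {τ : ℝ} (hτ0 : 0 < τ)
    (hτ1 : τ < 1) {n k : ℕ} (hk : k < n) :
    ∫ v, laguerrePoly ν ((1 - τ ^ 2) / (2 * τ)) n v *
      conj (laguerrePoly ν ((1 - τ ^ 2) / (2 * τ)) k v) * (Real.exp (τ * v.re) : ℂ) ∂m = 0 := by
  rw [(H.integral_laguerrePoly_mul_conj hτ0 hτ1 _ n k).2]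
  refine Finset.sum_eq_zero fun j hj => ?_
  rw [H.laguerreMoment_of_lt hν hτ0 hτ1 ((Finset.mem_range_succ_iff.1 hj).trans_lt hk), mul_zero]

/-- Conjugation exchanges the two indices. On the diagonal only the leading coefficient of the
conjugated factor contributes. -/
theorem integral_laguerrePoly_orthogonal (H : BesselMoments m A ν) (hν : -1 < ν) {τ : ℝ}
    (hτ0 : 0 < τ) (hτ1 : τ < 1) (n k : ℕ) :
    ∫ v, laguerrePoly ν ((1 - τ ^ 2) / (2 * τ)) n v *
      conj (laguerrePoly ν ((1 - τ ^ 2) / (2 * τ)) k v) * (Real.exp (τ * v.re) : ℂ) ∂m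
      = if n = k then (laguerreNorm A ν τ n : ℂ) else 0 := by
  rcases lt_trichotomy n k with h | rfl | h
  · rw [if_neg h.ne]
    have := congrArg conj (H.integral_laguerrePoly_of_lt hν hτ0 hτ1 h)
    rw [← integral_conj, map_zero] at this
    rw [← this]
    congr 1; ext v
    simp only [map_mul, Complex.conj_conj, Complex.conj_ofReal]
    ring
  · rw [if_pos rfl, (H.integral_laguerrePoly_mul_conj hτ0 hτ1 _ n n).2, Finset.sum_range_succ,
      Finset.sum_eq_zero fun j hj => by
        rw [H.laguerreMoment_of_lt hν hτ0 hτ1 (Finset.mem_range.1 hj), mul_zero],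
      zero_add, H.laguerreMoment_self hν hτ0 hτ1, ← Complex.ofReal_mul]
    congr 1
    have hpos : 0 < 1 - τ ^ 2 := by nlinarith
    rw [laguerreCoeff, laguerreNorm, Nat.choose_self, Nat.cast_one, mul_one,
      show -(ν + 1 + (n : ℝ)) = -(ν + 1) - n by ring, Real.rpow_sub hpos, Real.rpow_natCast]
    have h2 : (-((1 - τ ^ 2) / (2 * τ))) ^ n * (-2 / τ) ^ n
        = (1 - τ ^ 2) ^ n * (τ ^ (2 * n))⁻¹ := by
      rw [← mul_pow, pow_mul, ← inv_pow, ← mul_pow]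
      congr 1; field_simp
    have hG : Real.Gamma (ν + 1 + n) ≠ 0 := (Real.Gamma_pos_of_pos (by
      have : (0 : ℝ) ≤ n := n.cast_nonneg
      linarith)).ne'
    calc _ = ((-((1 - τ ^ 2) / (2 * τ))) ^ n * (-2 / τ) ^ n) * (A * n.factorial /
          Real.Gamma (ν + 1 + n)) * ((1 - τ ^ 2) ^ (-(ν + 1)) / (1 - τ ^ 2) ^ n) := by ring
      _ = _ := by rw [h2]; field_simp
  · rw [if_neg h.ne', H.integral_laguerrePoly_of_lt hν hτ0 hτ1 h]

end BesselMoments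

/-! ### The radial weight and its image under `z ↦ z^d`. -/

theorem measurable_besselK (ν : ℝ) : Measurable (besselK ν) := by
  have h : StronglyMeasurable (Function.uncurry fun x t : ℝ =>
      Real.exp (-x * Real.cosh t) * Real.cosh (ν * t)) := by
    refine Continuous.stronglyMeasurable ?_
    simp only [Function.uncurry_def]
    fun_prop
  exact (h.integral_prod_right (ν := volume.restrict (Ioi 0))).measurable

/-- The rotationally symmetric part of the weight of the ensemble. -/
noncomputable def besselWeight (d : ℕ) (ν : ℝ) (z : ℂ) : ℝ :=
  besselK ν (‖z‖ ^ d) * ‖z‖ ^ ((d : ℝ) * (ν + 2) - 2)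

theorem besselWeight_nonneg (d : ℕ) (ν : ℝ) (z : ℂ) : 0 ≤ besselWeight d ν z :=
  mul_nonneg (besselK_nonneg _ _) (Real.rpow_nonneg (norm_nonneg _) _)

theorem measurable_besselWeight (d : ℕ) (ν : ℝ) : Measurable (besselWeight d ν) := by
  have := measurable_besselK ν
  unfold besselWeight
  fun_prop

instance : (areaMeasure).IsAddHaarMeasure := by
  unfold areaMeasure
  exact Measure.IsAddHaarMeasure.smul _ (by simpa using Real.pi_pos) ENNReal.ofReal_ne_top

theorem areaMeasure_real_ball (z : ℂ) {r : ℝ} (hr : 0 ≤ r) :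
    areaMeasure.real (Metric.ball z r) = r ^ 2 := by
  rw [areaMeasure, measureReal_def, Measure.smul_apply, Complex.volume_ball, smul_eq_mul,
    ENNReal.toReal_mul, ENNReal.toReal_mul, ENNReal.toReal_pow, ENNReal.toReal_ofReal hr,
    ENNReal.toReal_ofReal (inv_pos.2 Real.pi_pos).le]
  simp only [ENNReal.coe_toReal, NNReal.coe_real_pi]
  field_simp

/-- On `(0,1]` the exponential is bounded and the zeroth moment suffices; beyond `1` the decay
`K_ν(t) ≤ e^{1-t} K_ν(1)` beats `e^{bt}`. -/
theorem integrableOn_rpow_mul_besselK_mul_exp {ν b : ℝ} (hν : -1 < ν) (hb : b < 1) :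
    IntegrableOn (fun t => t ^ (ν + 1) * besselK ν t * Real.exp (b * t)) (Ioi 0) := by
  have h1 : IntegrableOn (fun t => t ^ (ν + 1) * besselK ν t) (Ioi 0) := by
    simpa using (integral_rpow_mul_besselK hν 0).1
  have h2 : IntegrableOn (fun t => t ^ (ν + 1) * Real.exp (-(1 - b) * t)) (Ioi 0) := by
    simpa using integrableOn_rpow_mul_exp_neg_mul_rpow (p := 1) (s := ν + 1) (by linarith) one_pos
      (sub_pos.2 hb)
  have hK := measurable_besselK ν
  refine Integrable.mono' ((h1.const_mul (Real.exp |b|)).add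
    (h2.const_mul (Real.exp 1 * besselK ν 1)))
    (by fun_prop : Measurable fun t : ℝ => t ^ (ν + 1) * besselK ν t * Real.exp (b * t)).aestronglyMeasurable
    ((ae_restrict_iff' measurableSet_Ioi).2 (ae_of_all _ fun t ht => ?_))
  have ht : 0 < t := ht
  have hp := Real.rpow_pos_of_pos ht (ν + 1)
  have hKt := besselK_nonneg ν t
  have hK1 := besselK_nonneg ν 1
  rw [Real.norm_of_nonneg (by positivity)]
  simp only [Pi.add_apply]
  rcases le_total t 1 with h | h
  · have : Real.exp (b * t) ≤ Real.exp |b| := by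
      refine Real.exp_le_exp.2 ((le_abs_self _).trans ?_)
      rw [abs_mul, abs_of_pos ht]
      exact mul_le_of_le_one_right (abs_nonneg b) h
    have h3 := mul_le_mul_of_nonneg_left this (by positivity : 0 ≤ t ^ (ν + 1) * besselK ν t)
    have : 0 ≤ Real.exp 1 * besselK ν 1 * (t ^ (ν + 1) * Real.exp (-(1 - b) * t)) := by positivity
    linarith
  · have h3 := mul_le_mul_of_nonneg_left (besselK_le_exp h ν)
      (by positivity : 0 ≤ t ^ (ν + 1) * Real.exp (b * t))
    have h4 : t ^ (ν + 1) * Real.exp (b * t) * (Real.exp (1 - t) * besselK ν 1)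
        = Real.exp 1 * besselK ν 1 * (t ^ (ν + 1) * Real.exp (-(1 - b) * t)) := by
      rw [show 1 - t = 1 + -t by ring, show -(1 - b) * t = b * t + -t by ring, Real.exp_add,
        Real.exp_add]
      ring
    have : 0 ≤ Real.exp |b| * (t ^ (ν + 1) * besselK ν t) := by positivity
    linarith

/-- Polar coordinates followed by `t = y^d`: the exponent `d(ν+2)-2` is the one that leaves `t^{ν+1}
dt`. -/
theorem radial_besselWeight {d : ℕ} (hd : 1 ≤ d) (ν : ℝ) (g : ℝ → ℝ) {y : ℝ} (hy : 0 < y) :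
    y ^ (Module.finrank ℝ ℂ - 1) • (besselK ν (y ^ d) * y ^ ((d : ℝ) * (ν + 2) - 2) * g (y ^ d))
      = (d : ℝ)⁻¹ * ((|(d : ℝ)| * y ^ ((d : ℝ) - 1)) •
        (fun t : ℝ => t ^ (ν + 1) * besselK ν t * g t) (y ^ (d : ℝ))) := by
  have hd0 : (d : ℝ) ≠ 0 := by positivity
  rw [Complex.finrank_real_complex, abs_of_nonneg d.cast_nonneg]
  simp only [smul_eq_mul, Real.rpow_natCast]
  have : y ^ ((d : ℝ) - 1) * (y ^ d) ^ (ν + 1) = y * y ^ ((d : ℝ) * (ν + 2) - 2) := by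
    rw [← Real.rpow_natCast, ← Real.rpow_mul hy.le, ← Real.rpow_add hy]
    nth_rewrite 2 [← Real.rpow_one y]
    rw [← Real.rpow_add hy]
    congr 1; ring
  calc _ = y * y ^ ((d : ℝ) * (ν + 2) - 2) * (besselK ν (y ^ d) * g (y ^ d)) := by ring
    _ = _ := by rw [← this]; field_simp

theorem integral_radial_besselWeight {d : ℕ} (hd : 1 ≤ d) (ν : ℝ) (g : ℝ → ℝ) :
    ∫ z : ℂ, besselWeight d ν z * g (‖z‖ ^ d) ∂areaMeasure
      = 2 / d * ∫ t in Ioi (0 : ℝ), t ^ (ν + 1) * besselK ν t * g t := by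
  have hd0 : (d : ℝ) ≠ 0 := by positivity
  have h := integral_fun_norm_addHaar areaMeasure (E := ℂ) (fun r =>
    besselK ν (r ^ d) * r ^ ((d : ℝ) * (ν + 2) - 2) * g (r ^ d))
  simp only [besselWeight]
  have hcongr := setIntegral_congr_fun (μ := volume) measurableSet_Ioi
    fun (y : ℝ) (hy : y ∈ Ioi (0 : ℝ)) => radial_besselWeight hd ν g hy
  rw [h, hcongr, integral_const_mul,
    integral_comp_rpow_Ioi (fun t : ℝ => t ^ (ν + 1) * besselK ν t * g t) hd0, areaMeasure_real_ball _ zero_le_one, Complex.finrank_real_complex]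
  simp
  ring

theorem integrable_radial_besselWeight {d : ℕ} (hd : 1 ≤ d) (ν : ℝ) (g : ℝ → ℝ)
    (hg : IntegrableOn (fun t => t ^ (ν + 1) * besselK ν t * g t) (Ioi 0)) :
    Integrable (fun z : ℂ => besselWeight d ν z * g (‖z‖ ^ d)) areaMeasure := by
  have hd0 : (d : ℝ) ≠ 0 := by positivity
  have h := integrable_fun_norm_addHaar areaMeasure (E := ℂ) (f := fun r =>
    besselK ν (r ^ d) * r ^ ((d : ℝ) * (ν + 2) - 2) * g (r ^ d))
  simp only [besselWeight]
  have hcongr := integrableOn_congr_fun (μ := volume)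
    (fun (y : ℝ) (hy : y ∈ Ioi (0 : ℝ)) => radial_besselWeight hd ν g hy) measurableSet_Ioi
  rw [h, hcongr]
  exact Integrable.const_mul ((integrableOn_Ioi_comp_rpow_iff _ hd0).2 hg) _

/-- The image of the symmetric weight under `z ↦ z^d`. -/
noncomputable def powMeasure (d : ℕ) (ν : ℝ) : Measure ℂ :=
  (areaMeasure.withDensity fun z => ENNReal.ofReal (besselWeight d ν z)).map fun z => z ^ d

theorem integral_powMeasure (d : ℕ) (ν : ℝ) {f : ℂ → ℂ} (hf : Continuous f) :
    ∫ v, f v ∂(powMeasure d ν) = ∫ z, (besselWeight d ν z : ℂ) * f (z ^ d) ∂areaMeasure := by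
  rw [powMeasure, integral_map (by fun_prop) hf.aestronglyMeasurable,
    integral_withDensity_eq_integral_toReal_smul (measurable_besselWeight d ν).ennreal_ofReal
      (ae_of_all _ fun _ => ENNReal.ofReal_lt_top)]
  simp only [ENNReal.toReal_ofReal (besselWeight_nonneg _ _ _), Complex.real_smul]

theorem integrable_powMeasure_iff {E : Type*} [NormedAddCommGroup E] [NormedSpace ℝ E]
    [SecondCountableTopologyEither ℂ E] (d : ℕ) (ν : ℝ) {f : ℂ → E} (hf : Continuous f) :
    Integrable f (powMeasure d ν)
      ↔ Integrable (fun z => besselWeight d ν z • f (z ^ d)) areaMeasure := by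
  rw [powMeasure, integrable_map_measure hf.aestronglyMeasurable (by fun_prop),
    integrable_withDensity_iff_integrable_smul' (measurable_besselWeight d ν).ennreal_ofReal
      (ae_of_all _ fun _ => ENNReal.ofReal_lt_top)]
  simp only [ENNReal.toReal_ofReal (besselWeight_nonneg _ _ _), Function.comp]

theorem integral_rotation (c : Circle) (f : ℂ → ℂ) :
    ∫ z, f (c * z) ∂areaMeasure = ∫ z, f z ∂areaMeasure := by
  simp only [areaMeasure, integral_smul_measure]
  congr 1
  exact (rotation c).measurePreserving.integral_comp (rotation c).toHomeomorph.measurableEmbedding f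

theorem besselMoments_powMeasure {d : ℕ} (hd : 1 ≤ d) {ν : ℝ} (hν : -1 < ν) :
    BesselMoments (powMeasure d ν) (2 ^ (ν + 1) / d) ν where
  integrable_exp b hb := by
    rw [integrable_powMeasure_iff _ _ (by fun_prop)]
    simp only [norm_pow, smul_eq_mul]
    exact integrable_radial_besselWeight hd ν (fun t => Real.exp (b * t))
      (integrableOn_rpow_mul_besselK_mul_exp hν hb)
  moment j k := by
    have hd0 : (d : ℝ) ≠ 0 := by positivity
    rw [integral_powMeasure _ _ (by fun_prop)]
    split_ifs with h
    · subst h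
      have h1 : ∀ z : ℂ, (besselWeight d ν z : ℂ) * ((z ^ d) ^ j * conj (z ^ d) ^ j)
          = ((besselWeight d ν z * (‖z‖ ^ d) ^ (2 * j) : ℝ) : ℂ) := by
        intro z
        rw [← mul_pow, Complex.mul_conj, Complex.normSq_eq_norm_sq, norm_pow]
        push_cast; ring
      simp_rw [h1]
      rw [integral_complex_ofReal, integral_radial_besselWeight hd ν (fun t => t ^ (2 * j))]
      congr 1
      have h2 : ∀ t ∈ Ioi (0 : ℝ), t ^ (ν + 1) * besselK ν t * t ^ (2 * j)
          = t ^ (2 * j + ν + 1) * besselK ν t := by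
        intro t ht
        rw [show (2 * j + ν + 1 : ℝ) = (ν + 1) + (2 * j : ℕ) by push_cast; ring,
          Real.rpow_add ht (ν + 1), Real.rpow_natCast]
        ring
      rw [setIntegral_congr_fun measurableSet_Ioi h2, (integral_rpow_mul_besselK hν j).2,
        Real.rpow_add two_pos, Real.rpow_add two_pos, Real.rpow_one,
        show (2 * (j : ℝ)) = ((2 * j : ℕ) : ℝ) by push_cast; ring, Real.rpow_natCast, pow_mul]
      ring
    · set f : ℂ → ℂ := fun z => (besselWeight d ν z : ℂ) * ((z ^ d) ^ j * conj (z ^ d) ^ k) with hf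
      have hjk : ((j : ℝ) - k) ≠ 0 := sub_ne_zero.2 (by exact_mod_cast h)
      -- Rotation by this angle multiplies `v^j v̄^k` by `e^{iπ}`, so the rotation-invariant
      -- integral equals its own negative.
      set c := Circle.exp (Real.pi / (d * (j - k))) with hc
      have hcc : ((c : ℂ) ^ d) ^ j * conj ((c : ℂ) ^ d) ^ k = -1 := by
        rw [map_pow, ← Circle.coe_inv_eq_conj, hc, ← Circle.exp_neg, Circle.coe_exp, Circle.coe_exp,
          ← pow_mul, ← pow_mul, ← Complex.exp_nat_mul, ← Complex.exp_nat_mul, ← Complex.exp_add,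
          ← Complex.exp_pi_mul_I]
        congr 1
        have e1 : (d : ℂ) ≠ 0 := by exact_mod_cast hd0
        have e2 : ((j : ℂ) - k) ≠ 0 := by exact_mod_cast hjk
        push_cast
        field_simp
        ring
      have hneg : ∀ z, f (c * z) = -f z := by
        intro z
        have hw : besselWeight d ν (c * z) = besselWeight d ν z := by
          rw [besselWeight, norm_mul, Circle.norm_coe, one_mul, besselWeight]
        simp only [hf, hw]
        calc _ = (besselWeight d ν z : ℂ) * ((((c : ℂ) ^ d) ^ j * conj ((c : ℂ) ^ d) ^ k) *
              ((z ^ d) ^ j * conj (z ^ d) ^ k)) := by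
              simp only [mul_pow, map_mul, map_pow]; ring
          _ = _ := by rw [hcc]; ring
      have := integral_rotation c f
      simp_rw [hneg, integral_neg] at this
      exact neg_eq_self.1 this

/-! ### Slater determinants of orthonormal families. -/

section Determinantal
variable {X : Type*} {N : ℕ}

/-- The Slater determinant `det(φ_k(x_j))`. -/
noncomputable def slater (φ : Fin N → X → ℂ) (x : Fin N → X) : ℂ :=
  (Matrix.of fun k j => φ k (x j)).det

theorem slater_norm_sq (φ : Fin N → X → ℂ) (x : Fin N → X) :
    ((‖slater φ x‖ ^ 2 : ℝ) : ℂ)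
      = ∑ σ : Equiv.Perm (Fin N), ∑ ρ : Equiv.Perm (Fin N),
        ((Equiv.Perm.sign σ : ℤ) : ℂ) * ((Equiv.Perm.sign ρ : ℤ) : ℂ) *
          ∏ j, (φ (σ j) (x j) * conj (φ (ρ j) (x j))) := by
  rw [← Complex.normSq_eq_norm_sq, ← Complex.mul_conj, slater, Matrix.det_apply']
  simp only [Matrix.of_apply, map_sum, map_mul, map_prod, map_intCast, Finset.sum_mul_sum,
    Finset.prod_mul_distrib]
  refine Finset.sum_congr rfl fun σ _ => Finset.sum_congr rfl fun ρ _ => by ring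

variable [MeasurableSpace X]

/-- The measures may differ between coordinates, so that a single coordinate can later be confined
to a set `D`. -/
theorem integral_slater_norm_sq (μ : Fin N → Measure X) [∀ j, SigmaFinite (μ j)]
    {φ : Fin N → X → ℂ}
    (hφ : ∀ j k l, Integrable (fun x => φ k x * conj (φ l x)) (μ j)) :
    Integrable (fun x => ‖slater φ x‖ ^ 2) (Measure.pi μ) ∧
    ((∫ x, ‖slater φ x‖ ^ 2 ∂(Measure.pi μ) : ℝ) : ℂ)
      = ∑ σ : Equiv.Perm (Fin N), ∑ ρ : Equiv.Perm (Fin N),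
        ((Equiv.Perm.sign σ : ℤ) : ℂ) * ((Equiv.Perm.sign ρ : ℤ) : ℂ) *
          ∏ j, ∫ x, φ (σ j) x * conj (φ (ρ j) x) ∂(μ j) := by
  have hi : ∀ σ ρ : Equiv.Perm (Fin N), Integrable (fun x : Fin N → X =>
      ((Equiv.Perm.sign σ : ℤ) : ℂ) * ((Equiv.Perm.sign ρ : ℤ) : ℂ) *
          ∏ j, (φ (σ j) (x j) * conj (φ (ρ j) (x j)))) (Measure.pi μ) := fun σ ρ =>
    (Integrable.fintype_prod_dep (f := fun j x => φ (σ j) x * conj (φ (ρ j) x))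
      fun j => hφ j _ _).const_mul _
  have hi2 : Integrable (fun x => ((‖slater φ x‖ ^ 2 : ℝ) : ℂ)) (Measure.pi μ) := by
    simp_rw [slater_norm_sq]
    exact integrable_finsetSum _ fun σ _ => integrable_finsetSum _ fun ρ _ => hi σ ρ
  refine ⟨hi2.re.congr (ae_of_all _ fun x => Complex.ofReal_re _), ?_⟩
  rw [← integral_complex_ofReal]
  simp_rw [slater_norm_sq]
  rw [integral_finsetSum _ fun σ _ => integrable_finsetSum _ fun ρ _ => hi σ ρ]
  refine Finset.sum_congr rfl fun σ _ => ?_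
  rw [integral_finsetSum _ fun ρ _ => hi σ ρ]
  refine Finset.sum_congr rfl fun ρ _ => ?_
  rw [integral_const_mul,
    integral_fintype_prod_eq_prod (f := fun j x => φ (σ j) x * conj (φ (ρ j) x))]

variable {μ : Measure X} [SigmaFinite μ] {φ : Fin N → X → ℂ}

/-- Orthonormality of a finite family of functions. -/
structure OrthonormalFamily (μ : Measure X) (φ : Fin N → X → ℂ) : Prop where
  integrable : ∀ k l, Integrable (fun x => φ k x * conj (φ l x)) μ
  integral : ∀ k l, ∫ x, φ k x * conj (φ l x) ∂μ = if k = l then 1 else 0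

theorem sign_mul_sign_self (σ : Equiv.Perm (Fin N)) :
    ((Equiv.Perm.sign σ : ℤ) : ℂ) * ((Equiv.Perm.sign σ : ℤ) : ℂ) = 1 := by
  rw [← Int.cast_mul, ← Units.val_mul, Int.units_mul_self]; simp

theorem OrthonormalFamily.integral_slater (H : OrthonormalFamily μ φ) :
    Integrable (fun x => ‖slater φ x‖ ^ 2) (Measure.pi fun _ => μ) ∧
    ∫ x, ‖slater φ x‖ ^ 2 ∂(Measure.pi fun _ => μ) = N.factorial := by
  obtain ⟨h1, h2⟩ := integral_slater_norm_sq (fun _ => μ) (fun _ => H.integrable)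
  refine ⟨h1, Complex.ofReal_injective ?_⟩
  rw [h2]
  have : ∀ σ : Equiv.Perm (Fin N), ∑ ρ : Equiv.Perm (Fin N),
        ((Equiv.Perm.sign σ : ℤ) : ℂ) * ((Equiv.Perm.sign ρ : ℤ) : ℂ) *
          ∏ j, ∫ x, φ (σ j) x * conj (φ (ρ j) x) ∂μ = 1 := by
    intro σ
    rw [Finset.sum_eq_single σ]
    · simp [H.integral, sign_mul_sign_self]
    · intro ρ _ hρ
      obtain ⟨j, hj⟩ : ∃ j, σ j ≠ ρ j := by
        by_contra! h
        exact hρ (Equiv.ext fun j => (h j).symm)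
      rw [Finset.prod_eq_zero (Finset.mem_univ j) (by rw [H.integral, if_neg hj]), mul_zero]
    · simp
  simp_rw [this]
  simp [Fintype.card_perm]

/-- Orthogonality in the unrestricted coordinates forces `σ = ρ` away from `i`, and permutations
that agree off one point are equal. -/
theorem OrthonormalFamily.integral_slater_restrict (H : OrthonormalFamily μ φ) {D : Set X}
    (i : Fin N) :
    ∫ x in {x | x i ∈ D}, ‖slater φ x‖ ^ 2 ∂(Measure.pi fun _ => μ)
      = ∑ σ : Equiv.Perm (Fin N), ∫ x in D, ‖φ (σ i) x‖ ^ 2 ∂μ := by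
  set S : Fin N → Set X := Function.update (fun _ => univ) i D with hS
  have hset : {x : Fin N → X | x i ∈ D} = Set.pi univ S := by
    rw [hS, Set.univ_pi_update_univ]; rfl
  rw [hset, Measure.restrict_pi_pi]
  obtain ⟨-, h2⟩ := integral_slater_norm_sq (φ := φ) (fun j => μ.restrict (S j))
    (fun j k l => (H.integrable k l).restrict)
  refine Complex.ofReal_injective ?_
  rw [h2, Complex.ofReal_sum]
  refine Finset.sum_congr rfl fun σ _ => ?_
  have hne : ∀ j, j ≠ i → ∀ k l, ∫ x in S j, φ k x * conj (φ l x) ∂μ = if k = l then 1 else 0 := by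
    intro j hj k l
    rw [hS, Function.update_of_ne hj, Measure.restrict_univ, H.integral]
  rw [Finset.sum_eq_single σ]
  · rw [sign_mul_sign_self, one_mul, Finset.prod_eq_single i]
    · rw [hS, Function.update_self, ← integral_complex_ofReal]
      simp_rw [Complex.mul_conj, Complex.normSq_eq_norm_sq]
    · intro j _ hj
      rw [hne j hj, if_pos rfl]
    · simp
  · intro ρ _ hρ
    obtain ⟨j, hji, hj⟩ : ∃ j, j ≠ i ∧ σ j ≠ ρ j := by
      by_contra! h
      refine hρ (Equiv.ext fun j => ?_)
      by_cases hji : j = i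
      · subst hji
        by_contra hne'
        obtain ⟨k, hk⟩ := σ.surjective (ρ j)
        have hkj : k ≠ j := fun e => hne' (by rw [← hk, e])
        exact hkj (ρ.injective (by rw [← h k hkj, hk]))
      · exact (h j hji).symm
    rw [Finset.prod_eq_zero (Finset.mem_univ j) (by rw [hne j hji, if_neg hj]), mul_zero]
  · simp

theorem OrthonormalFamily.sum_integral_slater_restrict (H : OrthonormalFamily μ φ) {D : Set X} :
    ∑ i, ∫ x in {x | x i ∈ D}, ‖slater φ x‖ ^ 2 ∂(Measure.pi fun _ => μ)
      = N.factorial * ∑ k, ∫ x in D, ‖φ k x‖ ^ 2 ∂μ := by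
  simp_rw [H.integral_slater_restrict]
  rw [Finset.sum_comm]
  have : ∀ σ : Equiv.Perm (Fin N), ∑ i, ∫ x in D, ‖φ (σ i) x‖ ^ 2 ∂μ
      = ∑ k, ∫ x in D, ‖φ k x‖ ^ 2 ∂μ := fun σ =>
    Equiv.sum_comp σ fun k => ∫ x in D, ‖φ k x‖ ^ 2 ∂μ
  simp_rw [this]
  simp [Fintype.card_perm]

end Determinantal

/-! ### Gibbs measures whose density is a squared Slater determinant. -/

section Gibbs
variable {N d : ℕ} {Q : ℂ → ℝ} {φ : Fin N → ℂ → ℂ} {b β : ℝ}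

theorem partitionFunction_eq (H : OrthonormalFamily areaMeasure φ) (hb : 0 < b)
    (hB : boltzmannFactor d N β Q =ᵐ[areaMeasurePi N]
      fun x => ENNReal.ofReal (b * ‖slater φ x‖ ^ 2)) :
    partitionFunction d N β Q = ENNReal.ofReal (b * N.factorial) := by
  obtain ⟨h1, h2⟩ := H.integral_slater
  rw [partitionFunction, lintegral_congr_ae hB, areaMeasurePi,
    ← ofReal_integral_eq_lintegral_ofReal (h1.const_mul b) (ae_of_all _ fun x => by
      simp only [Pi.zero_apply]; positivity), integral_const_mul, h2]

theorem gibbsMeasure_isProbabilityMeasure (H : OrthonormalFamily areaMeasure φ) (hb : 0 < b)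
    (hB : boltzmannFactor d N β Q =ᵐ[areaMeasurePi N]
      fun x => ENNReal.ofReal (b * ‖slater φ x‖ ^ 2)) :
    IsProbabilityMeasure (gibbsMeasure d N β Q) := by
  have hZ := partitionFunction_eq H hb hB
  have hf : 0 < b * N.factorial := by positivity
  constructor
  rw [gibbsMeasure, Measure.smul_apply, withDensity_apply _ MeasurableSet.univ,
    Measure.restrict_univ, ← partitionFunction, smul_eq_mul, hZ]
  exact ENNReal.inv_mul_cancel (by simpa using hf) ENNReal.ofReal_ne_top

/-- The count is a sum of indicators, one per coordinate; the constants `b` and `N!` cancel against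
the partition function. -/
theorem integral_discCount (H : OrthonormalFamily areaMeasure φ) (hb : 0 < b)
    (hB : boltzmannFactor d N β Q =ᵐ[areaMeasurePi N]
      fun x => ENNReal.ofReal (b * ‖slater φ x‖ ^ 2)) (hφ : ∀ k, Measurable (φ k))
    (ζ : ℂ) (ε : ℝ) :
    ∫ x, (discCount ζ ε x : ℝ) ∂(gibbsMeasure d N β Q)
      = ∫ z in Metric.ball ζ ε, ∑ k, ‖φ k z‖ ^ 2 ∂areaMeasure := by
  have hZ := partitionFunction_eq H hb hB
  have hf : 0 < b * N.factorial := by positivity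
  obtain ⟨h1, h2⟩ := H.integral_slater
  have hms : Measurable (slater φ) := by
    have : slater φ = fun x => ∑ σ : Equiv.Perm (Fin N),
        ((Equiv.Perm.sign σ : ℤ) : ℂ) * ∏ j, φ (σ j) (x j) := by
      ext x; rw [slater, Matrix.det_apply']; rfl
    rw [this]
    fun_prop
  have hcount : ∀ x : Fin N → ℂ, (discCount ζ ε x : ℝ)
      = ∑ i, ({x : Fin N → ℂ | x i ∈ Metric.ball ζ ε}).indicator (fun _ => (1 : ℝ)) x := by
    intro x
    classical
    rw [discCount, Set.ncard_eq_toFinset_card']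
    simp only [Set.indicator_apply, Set.toFinset_ofPred, Finset.card_filter, Set.mem_ofPred_eq]
    push_cast
    exact Finset.sum_congr rfl fun i _ => by congr
  have hmb : ∀ i : Fin N, MeasurableSet {x : Fin N → ℂ | x i ∈ Metric.ball ζ ε} := fun i =>
    measurable_pi_apply i Metric.isOpen_ball.measurableSet
  rw [gibbsMeasure, withDensity_congr_ae hB, integral_smul_measure, hZ,
    integral_withDensity_eq_integral_toReal_smul (by fun_prop)
      (ae_of_all _ fun _ => ENNReal.ofReal_lt_top), areaMeasurePi]
  have hint : ∀ x : Fin N → ℂ, (ENNReal.ofReal (b * ‖slater φ x‖ ^ 2)).toReal • (discCount ζ ε x : ℝ)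
      = ∑ i, b * ({x : Fin N → ℂ | x i ∈ Metric.ball ζ ε}).indicator
        (fun x => ‖slater φ x‖ ^ 2) x := by
    intro x
    rw [ENNReal.toReal_ofReal (by positivity), hcount, smul_eq_mul, Finset.mul_sum]
    refine Finset.sum_congr rfl fun i _ => ?_
    by_cases h : x i ∈ Metric.ball ζ ε <;> simp [Set.indicator_apply]
  simp_rw [hint]
  rw [integral_finsetSum _ fun i _ => (h1.indicator (hmb i)).const_mul b]
  simp_rw [integral_const_mul, integral_indicator (hmb _)]
  rw [← Finset.mul_sum, H.sum_integral_slater_restrict, ENNReal.toReal_inv,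
    ENNReal.toReal_ofReal hf.le, integral_finsetSum _ fun k _ => ?_, smul_eq_mul]
  · field_simp
  · have := (H.integrable k k).re.integrableOn (s := Metric.ball ζ ε)
    refine this.congr (ae_of_all _ fun z => ?_)
    simp only [Complex.mul_conj, Complex.normSq_eq_norm_sq]
    exact Complex.ofReal_re _

/-- The intensity quotient converges to the limit of the correlation kernel on the diagonal. -/
theorem tendsto_intensityQuotient (H : OrthonormalFamily areaMeasure φ) (hb : 0 < b)
    (hB : boltzmannFactor d N β Q =ᵐ[areaMeasurePi N]
      fun x => ENNReal.ofReal (b * ‖slater φ x‖ ^ 2)) (hφ : ∀ k, Measurable (φ k))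
    {ζ : ℂ} {ℓ : ℝ} (hl : Tendsto (fun z => ∑ k, ‖φ k z‖ ^ 2) (𝓝[≠] ζ) (𝓝 ℓ)) :
    Tendsto (intensityQuotient (gibbsMeasure d N β Q) ζ) (𝓝[>] 0) (𝓝 ℓ) := by
  -- A punctured limit suffices because points are null; this allows `ζ = 0`, whatever value the
  -- weight takes there.
  have h1 : Tendsto (fun z => ∑ k, ‖φ k z‖ ^ 2) (𝓝 ζ ⊓ ae areaMeasure) (𝓝 ℓ) := by
    refine hl.mono_left ?_
    rw [nhdsWithin]
    refine inf_le_inf_left _ (le_principal_iff.2 ?_)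
    exact compl_mem_ae_iff.2 (measure_singleton ζ)
  have hs : Tendsto (fun ε : ℝ => Metric.ball ζ ε) (𝓝[>] 0) (𝓝 ζ).smallSets := by
    rw [tendsto_smallSets_iff]
    intro t ht
    obtain ⟨r, hr, hrt⟩ := Metric.mem_nhds_iff.1 ht
    filter_upwards [mem_nhdsWithin_of_mem_nhds (gt_mem_nhds hr)] with ε hε
    exact (Metric.ball_subset_ball (le_of_lt hε)).trans hrt
  have hm : StronglyMeasurableAtFilter (fun z => ∑ k, ‖φ k z‖ ^ 2) (𝓝 ζ) areaMeasure :=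
    ⟨univ, univ_mem, (by fun_prop : Measurable fun z => ∑ k, ‖φ k z‖ ^ 2).aestronglyMeasurable⟩
  -- With this normalization the disc has area exactly `ε²`, so the error in the disc integral is
  -- `o(ε²)`.
  have h2 := h1.integral_sub_linear_isLittleO_ae hm (Measure.finiteAt_nhds _ _) hs
    (m := fun ε => ε ^ 2) (by
      filter_upwards [self_mem_nhdsWithin] with ε hε
      exact areaMeasure_real_ball ζ (le_of_lt hε))
  have h3 := h2.tendsto_div_nhds_zero
  have h4 := h3.add_const ℓ
  rw [zero_add] at h4
  refine h4.congr' ?_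
  filter_upwards [self_mem_nhdsWithin] with ε hε
  have hε : ε ≠ 0 := ne_of_gt hε
  rw [intensityQuotient, integral_discCount H hb hB hφ, smul_eq_mul]
  field_simp
  ring

end Gibbs

/-! ### The orthonormal family of the ensemble -/

theorem laguerreNorm_pos {A ν τ : ℝ} (hA : 0 < A) (hν : -1 < ν) (hτ0 : 0 < τ) (hτ1 : τ < 1)
    (n : ℕ) : 0 < laguerreNorm A ν τ n := by
  have hG : 0 < Real.Gamma (ν + 1 + n) := Real.Gamma_pos_of_pos (by
    have : (0 : ℝ) ≤ n := n.cast_nonneg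
    linarith)
  have h1 : 0 < 1 - τ ^ 2 := by nlinarith
  have h2 := Real.rpow_pos_of_pos h1 (-(ν + 1))
  unfold laguerreNorm
  positivity

theorem laguerrePoly_eq_sum_fin (ν C : ℝ) {N : ℕ} (n : Fin N) (v : ℂ) :
    laguerrePoly ν C n v = ∑ j : Fin N, v ^ (j : ℕ) * (laguerreCoeff ν C n j : ℂ) := by
  rw [Fin.sum_univ_eq_sum_range (fun j => v ^ j * (laguerreCoeff ν C n j : ℂ)) N, laguerrePoly]
  rw [← Finset.sum_subset (Finset.range_subset_range.2 (Nat.succ_le_of_lt n.isLt))]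
  · exact Finset.sum_congr rfl fun j _ => mul_comm _ _
  · intro j _ hj
    have : (n : ℕ) < j := by simpa [Nat.lt_succ_iff] using hj
    simp [laguerreCoeff, Nat.choose_eq_zero_of_lt this]

/-- The transposed matrix is the Vandermonde matrix times the triangular matrix of coefficients. -/
theorem det_laguerrePoly (ν C : ℝ) {N : ℕ} (u : Fin N → ℂ) :
    (Matrix.of fun k j : Fin N => laguerrePoly ν C k (u j)).det
      = (∏ k : Fin N, (laguerreCoeff ν C k k : ℂ)) *
        ∏ i, ∏ j ∈ Finset.Ioi i, (u j - u i) := by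
  have h : (Matrix.of fun k j : Fin N => laguerrePoly ν C k (u j)).transpose
      = Matrix.vandermonde u *
        Matrix.of fun i j : Fin N => (laguerreCoeff ν C j i : ℂ) := by
    ext j k
    simp only [Matrix.transpose_apply, Matrix.of_apply, Matrix.mul_apply, Matrix.vandermonde_apply]
    exact laguerrePoly_eq_sum_fin ν C k (u j)
  rw [← Matrix.det_transpose, h, Matrix.det_mul, Matrix.det_vandermonde, mul_comm,
    Matrix.det_of_isUpperTriangular]
  · rfl
  · intro i j hij
    have : (j : ℕ) < i := hij
    simp [laguerreCoeff, Nat.choose_eq_zero_of_lt this]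

/-- The weight `K_ν(|z|^d)|z|^{d(ν+2)-2} e^{τ Re z^d}` of the rescaled system. -/
noncomputable def fullWeight (d : ℕ) (ν τ : ℝ) (z : ℂ) : ℝ :=
  besselWeight d ν z * Real.exp (τ * (z ^ d).re)

theorem fullWeight_nonneg (d : ℕ) (ν τ : ℝ) (z : ℂ) : 0 ≤ fullWeight d ν τ z :=
  mul_nonneg (besselWeight_nonneg _ _ _) (Real.exp_pos _).le

theorem measurable_fullWeight (d : ℕ) (ν τ : ℝ) : Measurable (fullWeight d ν τ) := by
  have := measurable_besselWeight d ν
  have h2 : Continuous fun z : ℂ => Real.exp (τ * (z ^ d).re) := by fun_prop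
  exact this.mul h2.measurable

/-- The orthonormal functions of the rescaled system. -/
noncomputable def waveFunction (d : ℕ) (ν τ : ℝ) (n : ℕ) (z : ℂ) : ℂ :=
  (Real.sqrt (fullWeight d ν τ z) : ℂ) *
    (((Real.sqrt (laguerreNorm (2 ^ (ν + 1) / d) ν τ n))⁻¹ : ℝ) : ℂ) *
    laguerrePoly ν ((1 - τ ^ 2) / (2 * τ)) n (z ^ d)

theorem measurable_waveFunction (d : ℕ) (ν τ : ℝ) (n : ℕ) : Measurable (waveFunction d ν τ n) := by
  have h1 := measurable_fullWeight d ν τ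
  have h2 := (continuous_laguerrePoly ν ((1 - τ ^ 2) / (2 * τ)) n).measurable
  unfold waveFunction
  fun_prop

theorem norm_waveFunction_sq {d : ℕ} (hd : 1 ≤ d) {ν τ : ℝ} (hν : -1 < ν) (hτ0 : 0 < τ)
    (hτ1 : τ < 1) (n : ℕ) (z : ℂ) :
    ‖waveFunction d ν τ n z‖ ^ 2 = fullWeight d ν τ z *
      (‖laguerrePoly ν ((1 - τ ^ 2) / (2 * τ)) n (z ^ d)‖ ^ 2 /
        laguerreNorm (2 ^ (ν + 1) / d) ν τ n) := by
  have hd0 : (0 : ℝ) < d := by exact_mod_cast hd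
  have hA : (0 : ℝ) < 2 ^ (ν + 1) / d := by positivity
  have hκ := laguerreNorm_pos hA hν hτ0 hτ1 n
  rw [waveFunction, norm_mul, norm_mul, Complex.norm_real, Complex.norm_real, Real.norm_eq_abs,
    Real.norm_eq_abs, mul_pow, mul_pow, sq_abs, sq_abs, inv_pow, Real.sq_sqrt hκ.le,
    Real.sq_sqrt (fullWeight_nonneg _ _ _ _)]
  field_simp

theorem orthonormal_waveFunction {d : ℕ} (hd : 1 ≤ d) {ν τ : ℝ} (hν : -1 < ν) (hτ0 : 0 < τ)
    (hτ1 : τ < 1) (N : ℕ) :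
    OrthonormalFamily areaMeasure fun k : Fin N => waveFunction d ν τ k := by
  have H := besselMoments_powMeasure hd hν
  have hd0 : (0 : ℝ) < d := by exact_mod_cast hd
  have hA : (0 : ℝ) < 2 ^ (ν + 1) / d := by positivity
  set A : ℝ := 2 ^ (ν + 1) / d with hAdef
  set C := (1 - τ ^ 2) / (2 * τ) with hC
  have hcont : ∀ k l : ℕ, Continuous fun v : ℂ => laguerrePoly ν C k v *
      conj (laguerrePoly ν C l v) * (Real.exp (τ * v.re) : ℂ) := fun k l => by
    have h1 := continuous_laguerrePoly ν C k
    have h2 := continuous_laguerrePoly ν C l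
    fun_prop
  have heq : ∀ (k l : ℕ) (z : ℂ), waveFunction d ν τ k z * conj (waveFunction d ν τ l z)
      = (((Real.sqrt (laguerreNorm A ν τ k))⁻¹ * (Real.sqrt (laguerreNorm A ν τ l))⁻¹ : ℝ) : ℂ) *
        ((besselWeight d ν z : ℂ) * (laguerrePoly ν C k (z ^ d) *
          conj (laguerrePoly ν C l (z ^ d)) * (Real.exp (τ * (z ^ d).re) : ℂ))) := by
    intro k l z
    have hs : ((Real.sqrt (fullWeight d ν τ z) : ℂ)) * (Real.sqrt (fullWeight d ν τ z) : ℂ)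
        = (besselWeight d ν z : ℂ) * (Real.exp (τ * (z ^ d).re) : ℂ) := by
      rw [← Complex.ofReal_mul, Real.mul_self_sqrt (fullWeight_nonneg _ _ _ _), fullWeight,
        Complex.ofReal_mul]
    simp only [waveFunction, map_mul, Complex.conj_ofReal, ← hAdef, ← hC]
    rw [Complex.ofReal_mul]
    linear_combination (((Real.sqrt (laguerreNorm A ν τ k))⁻¹ : ℝ) : ℂ) *
      (((Real.sqrt (laguerreNorm A ν τ l))⁻¹ : ℝ) : ℂ) * laguerrePoly ν C k (z ^ d) *
      conj (laguerrePoly ν C l (z ^ d)) * hs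
  constructor
  · intro k l
    simp_rw [heq]
    refine Integrable.const_mul ?_ _
    have := (integrable_powMeasure_iff d ν (hcont k l)).1
      (H.integral_laguerrePoly_mul_conj hτ0 hτ1 C k l).1
    simpa only [Complex.real_smul] using this
  · intro k l
    simp_rw [heq]
    rw [integral_const_mul, ← integral_powMeasure d ν (hcont k l),
      H.integral_laguerrePoly_orthogonal hν hτ0 hτ1]
    by_cases h : k = l
    · subst h
      have hκ := laguerreNorm_pos hA hν hτ0 hτ1 k
      rw [if_pos rfl, if_pos rfl, ← Complex.ofReal_mul, ← mul_inv, Real.mul_self_sqrt hκ.le,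
        inv_mul_cancel₀ hκ.ne', Complex.ofReal_one]
    · rw [if_neg h, if_neg (fun e => h (Fin.ext e)), mul_zero]

/-- The two factors `α⁻¹` compensate the planar Jacobian `α²`. -/
theorem OrthonormalFamily.comp_scale {N : ℕ} {φ : Fin N → ℂ → ℂ}
    (H : OrthonormalFamily areaMeasure φ) {α : ℝ} (hα : 0 < α) :
    OrthonormalFamily areaMeasure fun k z => (α : ℂ)⁻¹ * φ k (α⁻¹ • z) := by
  have heq : ∀ k l z, (α : ℂ)⁻¹ * φ k (α⁻¹ • z) * conj ((α : ℂ)⁻¹ * φ l (α⁻¹ • z))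
      = ((α : ℂ)⁻¹) ^ 2 * (φ k (α⁻¹ • z) * conj (φ l (α⁻¹ • z))) := by
    intro k l z
    rw [map_mul, map_inv₀, Complex.conj_ofReal]; ring
  constructor
  · intro k l
    simp_rw [heq]
    exact ((H.integrable k l).comp_smul (inv_ne_zero hα.ne')).const_mul _
  · intro k l
    simp_rw [heq]
    rw [integral_const_mul, Measure.integral_comp_inv_smul_of_nonneg areaMeasure
      (fun z => φ k z * conj (φ l z)) hα.le, H.integral, Complex.finrank_real_complex,
      Complex.real_smul]
    have : (α : ℂ) ≠ 0 := by exact_mod_cast hα.ne'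
    push_cast
    field_simp

/-! ### Null sets -/

theorem ae_eval_ne_zero (N : ℕ) : ∀ᵐ x ∂(areaMeasurePi N), ∀ j, x j ≠ 0 := by
  rw [ae_all_iff]
  intro j
  exact Measure.ae_eval_ne (fun _ : Fin N => areaMeasure) j 0

/-- Away from `x_k = 0`, a coincidence `x_j^d = x_k^d` means `x_j = ω x_k` with `ω^d = 1`. These are
finitely many proper real subspaces, hence null sets. -/
theorem ae_pow_ne_pow (d N : ℕ) (hd : 1 ≤ d) :
    ∀ᵐ x ∂(areaMeasurePi N), ∀ j k, j ≠ k → x j ^ d ≠ x k ^ d := by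
  have hlin : ∀ j k : Fin N, j ≠ k → ∀ ω ∈ Polynomial.nthRootsFinset d (1 : ℂ),
      ∀ᵐ x ∂(areaMeasurePi N), x j ≠ ω * x k := by
    intro j k hjk ω _
    let S : Submodule ℝ (Fin N → ℂ) :=
      { carrier := {x | x j = ω * x k}
        add_mem' := fun {x y} hx hy => by
          have hx : x j = ω * x k := hx
          have hy : y j = ω * y k := hy
          show (x + y) j = ω * (x + y) k
          rw [Pi.add_apply, Pi.add_apply, hx, hy]; ring
        zero_mem' := by simp
        smul_mem' := fun r x hx => by
          have hx : x j = ω * x k := hx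
          show (r • x) j = ω * (r • x) k
          rw [Pi.smul_apply, Pi.smul_apply, hx, mul_smul_comm] }
    have hS : S ≠ ⊤ := by
      intro h
      have : (Pi.single j 1 : Fin N → ℂ) ∈ S := h ▸ Submodule.mem_top
      have h2 : (Pi.single j 1 : Fin N → ℂ) j = ω * (Pi.single j 1 : Fin N → ℂ) k := this
      rw [Pi.single_eq_same, Pi.single_eq_of_ne hjk.symm, mul_zero] at h2
      exact one_ne_zero h2
    have : (areaMeasurePi N).IsAddHaarMeasure := by unfold areaMeasurePi; infer_instance
    exact compl_mem_ae_iff.2 (Measure.addHaar_submodule _ S hS)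
  have hall : ∀ᵐ x ∂(areaMeasurePi N), ∀ j k, j ≠ k →
      ∀ ω ∈ Polynomial.nthRootsFinset d (1 : ℂ), x j ≠ ω * x k := by
    rw [ae_all_iff]; intro j
    rw [ae_all_iff]; intro k
    refine eventually_imp_distrib_left.2 fun hjk => ?_
    exact (Finset.eventually_all _).2 (hlin j k hjk)
  filter_upwards [hall, ae_eval_ne_zero N] with x hx h0 j k hjk h
  refine hx j k hjk (x j / x k) ?_ (div_mul_cancel₀ _ (h0 k)).symm
  rw [Polynomial.mem_nthRootsFinset (by omega), div_pow, h, div_self (pow_ne_zero _ (h0 k))]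

/-! ### The Boltzmann factor as a squared Slater determinant. -/

theorem exp_neg_energy {d N : ℕ} {Q : ℂ → ℝ} {x : Fin N → ℂ}
    (hx : ∀ j k, j ≠ k → x j ^ d ≠ x k ^ d) :
    Real.exp (-(1 * energy d N Q x))
      = ‖∏ i, ∏ j ∈ Finset.Ioi i, (x j ^ d - x i ^ d)‖ ^ 2 *
        ∏ j, Real.exp (-(N * Q (x j))) := by
  have h1 : ∀ j k, j ≠ k → Real.exp (-Real.log (1 / ‖x j ^ d - x k ^ d‖)) = ‖x j ^ d - x k ^ d‖ := by
    intro j k hjk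
    rw [one_div, Real.log_inv, neg_neg, Real.exp_log (norm_pos_iff.2 (sub_ne_zero.2 (hx j k hjk)))]
  -- The energy runs over ordered pairs, so each difference occurs twice; hence the square.
  have h2 : ∏ j : Fin N, ∏ k ∈ Finset.univ.filter (fun k => k ≠ j), ‖x j ^ d - x k ^ d‖
      = ‖∏ i, ∏ j ∈ Finset.Ioi i, (x j ^ d - x i ^ d)‖ ^ 2 := by
    have := Finset.prod_prod_Ioi_mul_eq_prod_prod_off_diag fun j i : Fin N => ‖x j ^ d - x i ^ d‖
    have hc : ∀ i : Fin N, ({i}ᶜ : Finset (Fin N)) = Finset.univ.filter (fun k => k ≠ i) := by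
      intro i; ext k; simp
    simp_rw [hc] at this
    rw [norm_prod, ← Finset.prod_pow]
    simp_rw [norm_prod, ← Finset.prod_pow]
    calc _ = ∏ j : Fin N, ∏ k ∈ Finset.univ.filter (fun k => k ≠ j), ‖x k ^ d - x j ^ d‖ := by
          simp_rw [norm_sub_rev]
      _ = _ := by
          rw [← this]
          refine Finset.prod_congr rfl fun i _ => Finset.prod_congr rfl fun j _ => ?_
          rw [norm_sub_rev (x i ^ d), sq]
  rw [one_mul, energy, neg_add, Real.exp_add, ← Finset.sum_neg_distrib, Real.exp_sum, ← h2,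
    Finset.mul_sum, ← Finset.sum_neg_distrib, Real.exp_sum]
  congr 1
  refine Finset.prod_congr rfl fun j _ => ?_
  rw [← Finset.sum_neg_distrib, Real.exp_sum]
  exact Finset.prod_congr rfl fun k hk => h1 j k (by simpa using (Finset.mem_filter.1 hk).2.symm)

theorem scale_pow {d N : ℕ} (hd : 1 ≤ d) {c : ℝ} (hc : 0 < c) :
    ((c / N) ^ (2 / (d : ℝ))) ^ d = (c / N : ℝ) ^ 2 := by
  have hd0 : (d : ℝ) ≠ 0 := by positivity
  rw [← Real.rpow_natCast, ← Real.rpow_mul (by positivity), div_mul_cancel₀ _ hd0, Real.rpow_two]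

/-- The scale satisfies `α^{-d} = N²/c²`, and `N(N/c² - 1) = (1 - c²/N) N²/c²` identifies `τ = 1 -
c²/N`. -/
theorem exp_neg_potential {d N : ℕ} (hd : 1 ≤ d) (hN : 1 ≤ N) {c : ℝ} (hc : 0 < c) (ν : ℝ) {ζ : ℂ}
    (hζ : ζ ≠ 0) {α : ℝ} (hα : α = (c / N) ^ (2 / (d : ℝ))) :
    Real.exp (-(N * potential d N c ν ζ))
      = α ^ ((d : ℝ) * (ν + 2) - 2) * fullWeight d ν (1 - c ^ 2 / N) (α⁻¹ • ζ) := by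
  have hN0 : (0 : ℝ) < N := by exact_mod_cast hN
  have hα0 : 0 < α := by rw [hα]; positivity
  have hz : 0 < ‖ζ‖ := norm_pos_iff.2 hζ
  have hαd : (α⁻¹) ^ d = (N : ℝ) ^ 2 / c ^ 2 := by
    rw [inv_pow, hα, scale_pow hd hc, div_pow, inv_div]
  have hK : 0 < besselK ν ((N : ℝ) ^ 2 / c ^ 2 * ‖ζ‖ ^ d) := besselK_pos (by positivity) ν
  have hp : 0 < ‖ζ‖ ^ ((d : ℝ) * (ν + 2) - 2) := Real.rpow_pos_of_pos hz _
  rw [potential, one_div (besselK _ _ * _), Real.log_inv]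
  rw [show -((N : ℝ) * (1 / N * -Real.log (besselK ν ((N : ℝ) ^ 2 / c ^ 2 * ‖ζ‖ ^ d) *
      ‖ζ‖ ^ ((d : ℝ) * (ν + 2) - 2)) - (N / c ^ 2 - 1) * (ζ ^ d).re))
    = Real.log (besselK ν ((N : ℝ) ^ 2 / c ^ 2 * ‖ζ‖ ^ d) * ‖ζ‖ ^ ((d : ℝ) * (ν + 2) - 2))
      + N * (N / c ^ 2 - 1) * (ζ ^ d).re by field_simp; ring,
    Real.exp_add, Real.exp_log (mul_pos hK hp), fullWeight, besselWeight, norm_smul,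
    Real.norm_of_nonneg (inv_pos.2 hα0).le, mul_pow, hαd, smul_pow, hαd, Complex.smul_re,
    smul_eq_mul, Real.mul_rpow (inv_pos.2 hα0).le hz.le, Real.inv_rpow hα0.le]
  have hpα : α ^ ((d : ℝ) * (ν + 2) - 2) ≠ 0 := (Real.rpow_pos_of_pos hα0 _).ne'
  have he : (1 - c ^ 2 / N) * ((N : ℝ) ^ 2 / c ^ 2 * (ζ ^ d).re) = N * (N / c ^ 2 - 1) * (ζ ^ d).re := by
    field_simp
  rw [he]
  field_simp

/-- The orthonormal functions of the ensemble in the original scale. -/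
noncomputable def ensembleFunction (d N : ℕ) (c ν : ℝ) (k : Fin N) (ζ : ℂ) : ℂ :=
  (((c / N) ^ (2 / (d : ℝ)) : ℝ) : ℂ)⁻¹ *
    waveFunction d ν (1 - c ^ 2 / N) k (((c / N) ^ (2 / (d : ℝ)))⁻¹ • ζ)

theorem norm_slater_sq_eq {d N : ℕ} (hd : 1 ≤ d) {τ ν : ℝ} (hν : -1 < ν) (hτ0 : 0 < τ)
    (hτ1 : τ < 1) {α : ℝ} (hα : 0 < α) :
    ∃ b : ℝ, 0 < b ∧ ∀ x : Fin N → ℂ,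
      ‖slater (fun k z => (α : ℂ)⁻¹ * waveFunction d ν τ k (α⁻¹ • z)) x‖ ^ 2
        = b * (‖∏ i, ∏ j ∈ Finset.Ioi i, (x j ^ d - x i ^ d)‖ ^ 2 *
          ∏ j, fullWeight d ν τ (α⁻¹ • x j)) := by
  have hd0 : (0 : ℝ) < d := by exact_mod_cast hd
  have hA : (0 : ℝ) < 2 ^ (ν + 1) / d := by positivity
  set A : ℝ := 2 ^ (ν + 1) / d with hAdef
  set C := (1 - τ ^ 2) / (2 * τ) with hC
  have hC0 : 0 < C := by
    have : 0 < 1 - τ ^ 2 := by nlinarith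
    rw [hC]; positivity
  set κ : ℕ → ℝ := fun k => (Real.sqrt (laguerreNorm A ν τ k))⁻¹ with hκ
  have hκ0 : ∀ k, 0 < κ k := fun k => inv_pos.2 (Real.sqrt_pos.2 (laguerreNorm_pos hA hν hτ0 hτ1 k))
  -- All that is independent of the configuration: normalizations, the Jacobian factors, leading
  -- coefficients, and the powers of `α` from the Vandermonde product.
  set B : ℂ := ((∏ k : Fin N, κ k : ℝ) : ℂ) * ((∏ _k : Fin N, α⁻¹ : ℝ) : ℂ) *
    ((∏ k : Fin N, (laguerreCoeff ν C k k : ℂ)) * ∏ i : Fin N, ∏ j ∈ Finset.Ioi i, ((α⁻¹ : ℝ) : ℂ) ^ d)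
    with hB
  have hα' : ((α⁻¹ : ℝ) : ℂ) ≠ 0 := by exact_mod_cast (inv_pos.2 hα).ne'
  have hl : ∀ k, laguerreCoeff ν C k k ≠ 0 := fun k => by
    have hG : Real.Gamma (ν + 1 + k) ≠ 0 := (Real.Gamma_pos_of_pos (by
      have : (0 : ℝ) ≤ k := k.cast_nonneg
      linarith)).ne'
    rw [laguerreCoeff, Nat.choose_self]
    simp [hG, hC0.ne']
  have hB0 : B ≠ 0 := by
    rw [hB]
    refine mul_ne_zero (mul_ne_zero ?_ ?_) (mul_ne_zero ?_ ?_)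
    · exact_mod_cast (Finset.prod_pos (s := Finset.univ) (f := fun k : Fin N => κ k)
        fun k _ => hκ0 k).ne'
    · exact_mod_cast (Finset.prod_pos fun _ _ => inv_pos.2 hα).ne'
    · exact Finset.prod_ne_zero_iff.2 fun k _ => by exact_mod_cast hl k
    · exact Finset.prod_ne_zero_iff.2 fun i _ => Finset.prod_ne_zero_iff.2 fun j _ => pow_ne_zero _ hα'
  refine ⟨‖B‖ ^ 2, by positivity, fun x => ?_⟩
  have hdet : slater (fun k z => (α : ℂ)⁻¹ * waveFunction d ν τ k (α⁻¹ • z)) x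
      = B * (∏ i, ∏ j ∈ Finset.Ioi i, (x j ^ d - x i ^ d)) *
        ((∏ j, Real.sqrt (fullWeight d ν τ (α⁻¹ • x j)) : ℝ) : ℂ) := by
    have hmat : (Matrix.of fun k j : Fin N => (α : ℂ)⁻¹ * waveFunction d ν τ k (α⁻¹ • x j))
        = Matrix.of fun k j : Fin N => (κ k : ℂ) * (Matrix.of fun k j : Fin N =>
            (((α⁻¹ : ℝ) : ℂ) * (Real.sqrt (fullWeight d ν τ (α⁻¹ • x j)) : ℂ)) *
            (Matrix.of fun k j : Fin N => laguerrePoly ν C k ((α⁻¹ • x j) ^ d)) k j) k j := by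
      ext k j
      simp only [Matrix.of_apply, waveFunction, hκ, ← hAdef, ← hC]
      push_cast
      ring
    rw [slater, hmat, Matrix.det_mul_column, Matrix.det_mul_row, det_laguerrePoly]
    have hv : ∏ i : Fin N, ∏ j ∈ Finset.Ioi i, ((α⁻¹ • x j) ^ d - (α⁻¹ • x i) ^ d)
        = (∏ i : Fin N, ∏ j ∈ Finset.Ioi i, ((α⁻¹ : ℝ) : ℂ) ^ d) *
          ∏ i, ∏ j ∈ Finset.Ioi i, (x j ^ d - x i ^ d) := by
      simp_rw [← Finset.prod_mul_distrib]
      refine Finset.prod_congr rfl fun i _ => Finset.prod_congr rfl fun j _ => ?_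
      rw [Complex.real_smul, Complex.real_smul, mul_pow, mul_pow, mul_sub]
    rw [hv, Finset.prod_mul_distrib, hB]
    simp only [Complex.ofReal_prod]
    ring
  rw [hdet, norm_mul, norm_mul, mul_pow, mul_pow, Complex.norm_real, Real.norm_eq_abs, sq_abs,
    ← Finset.prod_pow]
  simp_rw [Real.sq_sqrt (fullWeight_nonneg _ _ _ _)]
  ring

theorem boltzmannFactor_ae_eq {d N : ℕ} (hd : 1 ≤ d) {c ν : ℝ} (hc : 0 < c) (hν : -1 < ν)
    (hN : c ^ 2 < N) :
    ∃ b : ℝ, 0 < b ∧ boltzmannFactor d N 1 (potential d N c ν) =ᵐ[areaMeasurePi N]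
      fun x => ENNReal.ofReal (b * ‖slater (ensembleFunction d N c ν) x‖ ^ 2) := by
  have hN0 : (0 : ℝ) < N := lt_of_le_of_lt (sq_nonneg c) hN
  have hN1 : 1 ≤ N := by exact_mod_cast hN0
  have hτ0 : 0 < 1 - c ^ 2 / N := by rw [sub_pos, div_lt_one hN0]; exact hN
  have hτ1 : 1 - c ^ 2 / N < 1 := by rw [sub_lt_self_iff]; positivity
  have hα0 : 0 < (c / N) ^ (2 / (d : ℝ)) := by positivity
  obtain ⟨b, hb, h⟩ := norm_slater_sq_eq (N := N) hd hν hτ0 hτ1 hα0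
  set α := (c / N) ^ (2 / (d : ℝ)) with hα
  have hp : 0 < α ^ ((d : ℝ) * (ν + 2) - 2) := Real.rpow_pos_of_pos hα0 _
  refine ⟨b⁻¹ * (α ^ ((d : ℝ) * (ν + 2) - 2)) ^ N, by positivity, ?_⟩
  -- The exceptional configurations are those at which a logarithm in the energy may have argument
  -- zero.
  filter_upwards [ae_eval_ne_zero N, ae_pow_ne_pow d N hd] with x h0 hx
  have h' : ‖slater (ensembleFunction d N c ν) x‖ ^ 2 = b * (‖∏ i, ∏ j ∈ Finset.Ioi i,
      (x j ^ d - x i ^ d)‖ ^ 2 * ∏ j, fullWeight d ν (1 - c ^ 2 / N) (α⁻¹ • x j)) := h x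
  rw [boltzmannFactor, exp_neg_energy hx, h']
  congr 1
  simp_rw [fun j => exp_neg_potential hd hN1 hc ν (h0 j) hα, Finset.prod_mul_distrib]
  rw [Finset.prod_const, Finset.card_univ, Fintype.card_fin]
  field_simp

/-! ### The one-point function as weight times kernel. -/

/-- The normalized sum `∑_{n<N} |p_n(v)|²/‖p_n‖²`. -/
noncomputable def laguerreKernel (d N : ℕ) (c ν : ℝ) (v : ℂ) : ℝ :=
  ∑ k : Fin N, ‖laguerrePoly ν ((1 - (1 - c ^ 2 / N) ^ 2) / (2 * (1 - c ^ 2 / N))) k v‖ ^ 2 /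
    laguerreNorm (2 ^ (ν + 1) / d) ν (1 - c ^ 2 / N) k

/-- Only the punctured limit `w` of the weight enters, so the origin and the other points are
treated alike. -/
theorem ensemble_spec {d N : ℕ} (hd : 1 ≤ d) {c ν : ℝ} (hc : 0 < c) (hν : -1 < ν)
    (hN : c ^ 2 < N) :
    IsProbabilityMeasure (ensemble d N c ν) ∧
    ∀ (z : ℂ) (w : ℝ), Tendsto (besselWeight d ν) (𝓝[≠] z) (𝓝 w) →
      Tendsto (intensityQuotient (ensemble d N c ν) ((((c / N) ^ (2 / (d : ℝ)) : ℝ) : ℂ) * z))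
        (𝓝[>] 0) (𝓝 ((((c / N) ^ (2 / (d : ℝ)))⁻¹) ^ 2 *
          (w * Real.exp ((1 - c ^ 2 / N) * (z ^ d).re) * laguerreKernel d N c ν (z ^ d)))) := by
  have hN0 : (0 : ℝ) < N := lt_of_le_of_lt (sq_nonneg c) hN
  have hτ0 : 0 < 1 - c ^ 2 / N := by rw [sub_pos, div_lt_one hN0]; exact hN
  have hτ1 : 1 - c ^ 2 / N < 1 := by rw [sub_lt_self_iff]; positivity
  have hα0 : 0 < (c / N) ^ (2 / (d : ℝ)) := by positivity
  obtain ⟨b, hb, hB⟩ := boltzmannFactor_ae_eq hd hc hν hN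
  have H : OrthonormalFamily areaMeasure (ensembleFunction d N c ν) :=
    (orthonormal_waveFunction hd hν hτ0 hτ1 N).comp_scale hα0
  refine ⟨gibbsMeasure_isProbabilityMeasure H hb hB, fun z w hw => ?_⟩
  set α := (c / N) ^ (2 / (d : ℝ)) with hα
  refine tendsto_intensityQuotient H hb hB (fun k => ?_) ?_
  · have := measurable_waveFunction d ν (1 - c ^ 2 / N) k
    unfold ensembleFunction
    fun_prop
  · have hsum : ∀ ζ : ℂ, ∑ k, ‖ensembleFunction d N c ν k ζ‖ ^ 2
        = (α⁻¹) ^ 2 * (besselWeight d ν (α⁻¹ • ζ) *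
          Real.exp ((1 - c ^ 2 / N) * ((α⁻¹ • ζ) ^ d).re) *
          laguerreKernel d N c ν ((α⁻¹ • ζ) ^ d)) := by
      intro ζ
      rw [laguerreKernel, Finset.mul_sum, Finset.mul_sum]
      refine Finset.sum_congr rfl fun k _ => ?_
      rw [ensembleFunction, norm_mul, mul_pow, norm_waveFunction_sq hd hν hτ0 hτ1, ← hα,
        fullWeight, norm_inv, Complex.norm_real, Real.norm_of_nonneg hα0.le]
    simp_rw [hsum]
    have hcont : Continuous fun ζ : ℂ => α⁻¹ • ζ := by fun_prop
    have hval : α⁻¹ • ((α : ℂ) * z) = z := by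
      rw [Complex.real_smul, Complex.ofReal_inv, inv_mul_cancel_left₀ (by exact_mod_cast hα0.ne')]
    have hmap : Tendsto (fun ζ : ℂ => α⁻¹ • ζ) (𝓝[≠] ((α : ℂ) * z)) (𝓝[≠] z) := by
      refine tendsto_nhdsWithin_iff.2 ⟨?_, ?_⟩
      · have := hcont.tendsto ((α : ℂ) * z)
        rw [hval] at this
        exact this.mono_left nhdsWithin_le_nhds
      · filter_upwards [self_mem_nhdsWithin] with ζ hζ h
        refine hζ ?_
        have h : α⁻¹ • ζ = z := h
        show ζ = _
        rw [← h, Complex.real_smul, Complex.ofReal_inv,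
          mul_inv_cancel_left₀ (by exact_mod_cast hα0.ne')]
    have hk : Continuous fun y : ℂ => Real.exp ((1 - c ^ 2 / N) * (y ^ d).re) *
        laguerreKernel d N c ν (y ^ d) := by
      have := fun n => continuous_laguerrePoly ν
        ((1 - (1 - c ^ 2 / N) ^ 2) / (2 * (1 - c ^ 2 / N))) n
      unfold laguerreKernel
      fun_prop
    have h1 := (hw.mul ((hk.tendsto z).mono_left nhdsWithin_le_nhds)).const_mul ((α⁻¹) ^ 2)
    simpa only [mul_assoc, Function.comp_def] using h1.comp hmap

theorem rescaledOnePoint_eq {d N : ℕ} (hd : 1 ≤ d) {c ν : ℝ} (hc : 0 < c) (hν : -1 < ν)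
    (hN : c ^ 2 < N) {z : ℂ} {w : ℝ} (hw : Tendsto (besselWeight d ν) (𝓝[≠] z) (𝓝 w)) :
    rescaledOnePoint d N c ν z
      = w * Real.exp ((1 - c ^ 2 / N) * (z ^ d).re) * laguerreKernel d N c ν (z ^ d) := by
  have hN0 : (0 : ℝ) < N := lt_of_le_of_lt (sq_nonneg c) hN
  have hα0 : 0 < (c / N) ^ (2 / (d : ℝ)) := by positivity
  have h := ((ensemble_spec hd hc hν hN).2 z w hw).limUnder_eq
  have h4 : (c / N) ^ (4 / (d : ℝ)) = ((c / N) ^ (2 / (d : ℝ))) ^ 2 := by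
    rw [← Real.rpow_natCast, ← Real.rpow_mul (by positivity)]
    congr 1; push_cast; ring
  rw [rescaledOnePoint, onePointFunction, h, h4]
  field_simp

theorem tendsto_besselWeight (d : ℕ) (ν : ℝ) {z : ℂ} (hz : z ≠ 0) :
    ContinuousAt (besselWeight d ν) z := by
  have hz' : 0 < ‖z‖ := norm_pos_iff.2 hz
  have h1 : ContinuousAt (besselK ν) (‖z‖ ^ d) :=
    (continuousOn_besselK ν).continuousAt (Ioi_mem_nhds (pow_pos hz' d))
  have h2 : ContinuousAt (fun z : ℂ => ‖z‖ ^ d) z := by fun_prop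
  have h3 : ContinuousAt (fun z : ℂ => ‖z‖ ^ ((d : ℝ) * (ν + 2) - 2)) z :=
    continuous_norm.continuousAt.rpow_const (Or.inl hz'.ne')
  exact (ContinuousAt.comp (f := fun z : ℂ => ‖z‖ ^ d) h1 h2).mul h3

theorem exists_tendsto_besselWeight_zero {d : ℕ} (hd : 1 ≤ d) {ν : ℝ}
    (h : BoundedAtOrigin d ν) : ∃ w : ℝ, Tendsto (besselWeight d ν) (𝓝[≠] 0) (𝓝 w) := by
  obtain ⟨w, hw⟩ := exists_tendsto_rpow_mul_besselK_of_boundedAtOrigin hd h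
  have hd0 : (d : ℝ) ≠ 0 := by positivity
  have hm : Tendsto (fun z : ℂ => ‖z‖ ^ d) (𝓝[≠] 0) (𝓝[>] 0) := by
    refine tendsto_nhdsWithin_iff.2 ⟨?_, ?_⟩
    · have : Continuous fun z : ℂ => ‖z‖ ^ d := by fun_prop
      have := this.tendsto 0
      rw [norm_zero, zero_pow (by omega)] at this
      exact this.mono_left nhdsWithin_le_nhds
    · filter_upwards [self_mem_nhdsWithin] with z hz
      exact pow_pos (norm_pos_iff.2 hz) d
  refine ⟨w, (hw.comp hm).congr fun z => ?_⟩
  rw [Function.comp, besselWeight, ← Real.rpow_natCast, ← Real.rpow_mul (norm_nonneg _), mul_comm]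
  congr 2
  field_simp

/-! ### Asymptotics of the Gamma quotient -/

theorem GammaSeq_eq {s : ℝ} (hs : 0 < s) (n : ℕ) :
    Real.GammaSeq s n = n ^ s * n.factorial * Real.Gamma s / Real.Gamma (s + (n + 1 : ℕ)) := by
  have h : ∀ m : ℕ, Real.Gamma (s + m) = (∏ j ∈ Finset.range m, (s + j)) * Real.Gamma s := by
    intro m
    induction m with
    | zero => simp
    | succ m ih =>
      have : s + m ≠ 0 := by positivity
      rw [Finset.prod_range_succ, Nat.cast_succ, ← add_assoc, Real.Gamma_add_one this, ih]; ring
  have hG := (Real.Gamma_pos_of_pos hs).ne'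
  rw [Real.GammaSeq, h]
  field_simp

/-- Euler's limit for `Γ(ν+1)`; its denominator is `Γ(ν+2+n)`, and the factor `n/(n+ν+1)` corrects
the shift. -/
theorem tendsto_Gamma_div {ν : ℝ} (hν : -1 < ν) :
    Tendsto (fun n : ℕ => Real.Gamma (ν + 1 + n) / (n.factorial * (n : ℝ) ^ ν)) atTop (𝓝 1) := by
  have hs : 0 < ν + 1 := by linarith
  have hG := Real.Gamma_pos_of_pos hs
  have h1 := (Real.GammaSeq_tendsto_Gamma (ν + 1)).div_const (Real.Gamma (ν + 1))
  rw [div_self hG.ne'] at h1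
  have h2 : Tendsto (fun n : ℕ => (n : ℝ) / (n + (ν + 1))) atTop (𝓝 1) :=
    tendsto_natCast_div_add_atTop (ν + 1)
  have h3 := h2.div h1 one_ne_zero
  rw [div_one] at h3
  refine h3.congr' ?_
  filter_upwards [eventually_ge_atTop 1] with n hn
  have hn0 : (0 : ℝ) < n := by exact_mod_cast hn
  have hne : 0 < ν + 1 + n := by linarith
  have hGn : 0 < Real.Gamma (ν + 1 + n) := Real.Gamma_pos_of_pos hne
  have hp := Real.rpow_pos_of_pos hn0 ν
  simp only [Pi.div_apply]
  rw [GammaSeq_eq hs, Nat.cast_succ, ← add_assoc (ν + 1), Real.Gamma_add_one hne.ne',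
    Real.rpow_add_one hn0.ne', add_comm (n : ℝ) (ν + 1)]
  field_simp

/-- The base `n + 1` instead of `n` keeps the bound meaningful at `n = 0`. -/
theorem exists_Gamma_div_le {ν : ℝ} (hν : -1 < ν) :
    ∃ M : ℝ, 0 < M ∧ ∀ n : ℕ, Real.Gamma (ν + 1 + n) / n.factorial ≤ M * ((n : ℝ) + 1) ^ ν := by
  have h1 := tendsto_Gamma_div hν
  have h2 : Tendsto (fun n : ℕ => ((n : ℝ) / (n + 1)) ^ ν) atTop (𝓝 1) := by
    have := (tendsto_natCast_div_add_atTop (1 : ℝ)).rpow_const (p := ν) (Or.inl one_ne_zero)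
    rwa [Real.one_rpow] at this
  have h3 := h1.mul h2
  have h4 : Tendsto (fun n : ℕ => Real.Gamma (ν + 1 + n) / (n.factorial * ((n : ℝ) + 1) ^ ν))
      atTop (𝓝 (1 * 1)) := by
    refine h3.congr' ?_
    filter_upwards [eventually_ge_atTop 1] with n hn
    have hn0 : (0 : ℝ) < n := by exact_mod_cast hn
    have hp := Real.rpow_pos_of_pos hn0 ν
    have hp1 := Real.rpow_pos_of_pos (by positivity : (0 : ℝ) < n + 1) ν
    rw [Real.div_rpow hn0.le (by positivity)]
    field_simp
  obtain ⟨M, hM⟩ := h4.bddAbove_range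
  refine ⟨max M 1, by positivity, fun n => ?_⟩
  have hp1 := Real.rpow_pos_of_pos (by positivity : (0 : ℝ) < (n : ℝ) + 1) ν
  have h5 : Real.Gamma (ν + 1 + n) / (n.factorial * ((n : ℝ) + 1) ^ ν) ≤ max M 1 :=
    (hM ⟨n, rfl⟩).trans (le_max_left M 1)
  rw [← div_div, div_le_iff₀ hp1] at h5
  exact h5

/-- Gamma increases on `[2, ∞)`, where it is at least `Γ(2) = 1`; only `j = 0, 1` can fall outside.
-/
theorem exists_Gamma_ge {ν : ℝ} (hν : -1 < ν) :
    ∃ δ : ℝ, 0 < δ ∧ ∀ j : ℕ, δ ≤ Real.Gamma (ν + 1 + j) := by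
  have h0 : 0 < Real.Gamma (ν + 1) := Real.Gamma_pos_of_pos (by linarith)
  have h1 : 0 < Real.Gamma (ν + 1 + 1) := Real.Gamma_pos_of_pos (by linarith)
  refine ⟨min (min (Real.Gamma (ν + 1)) (Real.Gamma (ν + 1 + 1))) 1, by positivity, fun j => ?_⟩
  match j with
  | 0 => simp
  | 1 => simp
  | j + 2 =>
    refine (min_le_right _ _).trans (Real.Gamma_two.symm.le.trans ?_)
    have : (2 : ℝ) ≤ ν + 1 + ((j + 2 : ℕ) : ℝ) := by
      have : (0 : ℝ) ≤ j := j.cast_nonneg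
      push_cast; linarith
    exact Real.Gamma_strictMonoOn_Ici.monotoneOn (by simp) this this

/-! ### Riemann sums -/

/-- Writing the sum as the integral of a step function on `(0,1)` makes dominated convergence
applicable to it. -/
theorem sum_eq_mul_integral_floor (a : ℕ → ℝ) {N : ℕ} (hN : 1 ≤ N) :
    ∑ n ∈ Finset.range N, a n = N * ∫ x in Ioo (0 : ℝ) 1, a ⌊x * N⌋₊ := by
  have hN0 : (N : ℝ) ≠ 0 := by positivity
  have hpiece : ∀ n : ℕ, EqOn (fun y : ℝ => a ⌊y⌋₊) (fun _ => a n) (Ico (n : ℝ) (n + 1 : ℕ)) := by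
    intro n y hy
    have : ⌊y⌋₊ = n := (Nat.floor_eq_iff ((Nat.cast_nonneg n).trans hy.1)).2
      ⟨hy.1, by exact_mod_cast hy.2⟩
    simp [this]
  have hle : ∀ n : ℕ, (n : ℝ) ≤ (n + 1 : ℕ) := fun n => by exact_mod_cast n.le_succ
  have hint : ∀ k < N, IntervalIntegrable (fun y : ℝ => a ⌊y⌋₊) volume (k : ℕ) ((k + 1 : ℕ) : ℝ) := by
    intro k _
    rw [intervalIntegrable_iff_integrableOn_Ico_of_le (hle k),
      integrableOn_congr_fun (hpiece k) measurableSet_Ico]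
    exact integrableOn_const (by simp)
  have h1 := intervalIntegral.sum_integral_adjacent_intervals (a := fun k : ℕ => (k : ℝ)) hint
  have h2 : ∀ n : ℕ, ∫ y in (n : ℝ)..((n + 1 : ℕ) : ℝ), a ⌊y⌋₊ = a n := by
    intro n
    rw [intervalIntegral.integral_of_le (hle n), ← integral_Ico_eq_integral_Ioc,
      setIntegral_congr_fun measurableSet_Ico (hpiece n), setIntegral_const]
    simp
  simp_rw [h2] at h1
  rw [h1, ← integral_Ioc_eq_integral_Ioo, ← intervalIntegral.integral_of_le zero_le_one,
    intervalIntegral.integral_comp_mul_right (fun y => a ⌊y⌋₊) hN0, zero_mul, one_mul,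
    smul_eq_mul, Nat.cast_zero]
  field_simp

/-! ### The Mehler–Heine limit -/

/-- The entire function `∑_k (-x)^k / (k! Γ(ν+k+1))`. -/
noncomputable def besselEntire (ν : ℝ) (x : ℂ) : ℂ :=
  ∑' k : ℕ, (-1 : ℂ) ^ k / ((Nat.factorial k : ℂ) * (Real.Gamma (ν + k + 1) : ℂ)) * x ^ k

theorem laguerrePoly_eq_tsum (ν C : ℝ) (n : ℕ) (v : ℂ) :
    laguerrePoly ν C n v = ∑' j : ℕ, (laguerreCoeff ν C n j : ℂ) * v ^ j := by
  rw [laguerrePoly, tsum_eq_sum]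
  intro j hj
  have : n < j := by simpa [Nat.lt_succ_iff] using hj
  simp [laguerreCoeff, Nat.choose_eq_zero_of_lt this]

theorem norm_laguerreCoeff_mul_pow_le {ν C δ B : ℝ} (hC : 0 ≤ C) (hδ : 0 < δ)
    (hG : ∀ j : ℕ, δ ≤ Real.Gamma (ν + 1 + j)) {n : ℕ} {v : ℂ} (hB : C * n * ‖v‖ ≤ B) (j : ℕ) :
    ‖(laguerreCoeff ν C n j : ℂ) * v ^ j‖ ≤ B ^ j / j.factorial * δ⁻¹ := by
  have hGj : 0 < Real.Gamma (ν + 1 + j) := hδ.trans_le (hG j)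
  have h1 : (n.choose j : ℝ) ≤ (n : ℝ) ^ j / j.factorial := Nat.choose_le_pow_div j n
  have h0 : 0 ≤ C * n * ‖v‖ := by positivity
  rw [norm_mul, norm_pow, Complex.norm_real, laguerreCoeff, norm_div, norm_mul, norm_pow, norm_neg,
    Real.norm_of_nonneg hC, Real.norm_of_nonneg hGj.le, Real.norm_natCast]
  calc C ^ j * n.choose j / Real.Gamma (ν + 1 + j) * ‖v‖ ^ j
      ≤ C ^ j * (n ^ j / j.factorial) / δ * ‖v‖ ^ j := by
        gcongr
        exact hG j
    _ = (C * n * ‖v‖) ^ j / j.factorial * δ⁻¹ := by rw [mul_pow, mul_pow]; field_simp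
    _ ≤ _ := by gcongr

theorem summable_pow_div_factorial_mul (B δ : ℝ) :
    Summable fun j : ℕ => B ^ j / j.factorial * δ⁻¹ :=
  (Real.summable_pow_div_factorial B).mul_right _

theorem norm_laguerrePoly_le {ν C δ B : ℝ} (hC : 0 ≤ C) (hδ : 0 < δ)
    (hG : ∀ j : ℕ, δ ≤ Real.Gamma (ν + 1 + j)) {n : ℕ} {v : ℂ} (hB : C * n * ‖v‖ ≤ B) :
    ‖laguerrePoly ν C n v‖ ≤ ∑' j : ℕ, B ^ j / j.factorial * δ⁻¹ := by
  rw [laguerrePoly_eq_tsum]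
  exact tsum_of_norm_bounded (summable_pow_div_factorial_mul B δ).hasSum
    (norm_laguerreCoeff_mul_pow_le hC hδ hG hB)

/-- Termwise, `C^j binom(n,j) = ∏_{i<j} C(n-i) / j!` tends to `y^j/j!`, and an exponential series
dominates. The general filter lets the point `v` move with `N`. -/
theorem tendsto_laguerrePoly {ι : Type*} {l : Filter ι} {ν y : ℝ} (hν : -1 < ν) {C : ι → ℝ}
    {n : ι → ℕ} {v : ι → ℂ} {v₀ : ℂ} (hC0 : ∀ᶠ i in l, 0 ≤ C i) (hC : Tendsto C l (𝓝 0))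
    (hn : Tendsto (fun i => C i * n i) l (𝓝 y)) (hv : Tendsto v l (𝓝 v₀))
    (hnt : Tendsto n l atTop) :
    Tendsto (fun i => laguerrePoly ν (C i) (n i) (v i)) l (𝓝 (besselEntire ν (y * v₀))) := by
  obtain ⟨δ, hδ, hG⟩ := exists_Gamma_ge hν
  simp_rw [laguerrePoly_eq_tsum]
  unfold besselEntire
  have hb : ∀ᶠ i in l, C i * n i * ‖v i‖ < y * ‖v₀‖ + 1 :=
    (hn.mul hv.norm).eventually_lt_const (lt_add_one _)
  refine tendsto_tsum_of_dominated_convergence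
    (summable_pow_div_factorial_mul (y * ‖v₀‖ + 1) δ) (fun j => ?_) ?_
  · have hfac : ∀ i : ℕ, Tendsto (fun a => C a * ((n a - i : ℕ) : ℝ)) l (𝓝 y) := by
      intro i
      have h1 := hn.sub (hC.mul_const (i : ℝ))
      rw [zero_mul, sub_zero] at h1
      refine h1.congr' ?_
      filter_upwards [hnt.eventually_ge_atTop i] with a ha
      rw [Nat.cast_sub ha]; ring
    have hprod : Tendsto (fun a => C a ^ j * ((n a).choose j : ℝ)) l (𝓝 (y ^ j / j.factorial)) := by
      have h1 := (tendsto_finsetProd (Finset.range j) fun i _ => hfac i).div_const (j.factorial : ℝ)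
      simp only [Finset.prod_const, Finset.card_range] at h1
      refine h1.congr fun a => ?_
      rw [Finset.prod_mul_distrib, Finset.prod_const, Finset.card_range, ← Nat.cast_prod,
        ← Nat.descFactorial_eq_prod_range, Nat.descFactorial_eq_factorial_mul_choose]
      have : (j.factorial : ℝ) ≠ 0 := by exact_mod_cast j.factorial_ne_zero
      push_cast
      field_simp
    have h2 := ((hprod.const_mul ((-1) ^ j)).div_const (Real.Gamma (ν + 1 + j))).ofReal.mul (hv.pow j)
    have h3 : (((-1) ^ j * (y ^ j / j.factorial) / Real.Gamma (ν + 1 + j) : ℝ) : ℂ) * v₀ ^ j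
        = (-1 : ℂ) ^ j / ((Nat.factorial j : ℂ) * (Real.Gamma (ν + j + 1) : ℂ)) * (y * v₀) ^ j := by
      rw [show ν + j + 1 = ν + 1 + j by ring]
      push_cast
      rw [mul_pow]
      field_simp
    rw [h3] at h2
    refine h2.congr fun a => ?_
    rw [laguerreCoeff, neg_pow]
    congr 2
    ring
  · filter_upwards [hb, hC0] with i hi hCi j
    exact norm_laguerreCoeff_mul_pow_le hCi hδ hG hi.le j

/-! ### Dominated convergence for the kernel. -/

/-- The limit of `laguerreKernel`. -/
noncomputable def limitKernel (d : ℕ) (c ν : ℝ) (v : ℂ) : ℝ :=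
  (2 * c ^ 2) ^ (ν + 1) / (2 ^ (ν + 1) / d) *
    ∫ x in Ioo (0 : ℝ) 1, x ^ ν * Real.exp (-(2 * c ^ 2 * x)) *
      ‖besselEntire ν ((c ^ 2 * x : ℝ) * v)‖ ^ 2

/-- The Riemann sum integrand of `laguerreKernel`. -/
noncomputable def kernelIntegrand (N : ℕ) (c ν : ℝ) (v : ℂ) (x : ℝ) : ℝ :=
  Real.Gamma (ν + 1 + ⌊x * N⌋₊) / ((⌊x * N⌋₊).factorial * (N : ℝ) ^ ν) *
    (1 - c ^ 2 / N) ^ (2 * ⌊x * N⌋₊) *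
    ‖laguerrePoly ν ((1 - (1 - c ^ 2 / N) ^ 2) / (2 * (1 - c ^ 2 / N))) ⌊x * N⌋₊ v‖ ^ 2

theorem laguerreKernel_eq_integral {d N : ℕ} (hd : 1 ≤ d) {c ν : ℝ} (hc : 0 < c) (hν : -1 < ν)
    (hN : c ^ 2 < N) (v : ℂ) :
    laguerreKernel d N c ν v
      = (N * (1 - (1 - c ^ 2 / N) ^ 2)) ^ (ν + 1) / (2 ^ (ν + 1) / d) *
        ∫ x in Ioo (0 : ℝ) 1, kernelIntegrand N c ν v x := by
  have hN0 : (0 : ℝ) < N := lt_of_le_of_lt (sq_nonneg c) hN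
  have hN1 : 1 ≤ N := by exact_mod_cast hN0
  have hd0 : (0 : ℝ) < d := by exact_mod_cast hd
  have hτ0 : 0 < 1 - c ^ 2 / N := by rw [sub_pos, div_lt_one hN0]; exact hN
  have hτ1 : 1 - c ^ 2 / N < 1 := by rw [sub_lt_self_iff]; positivity
  set τ := 1 - c ^ 2 / N with hτ
  have hpos : 0 < 1 - τ ^ 2 := by nlinarith
  have hNν := Real.rpow_pos_of_pos hN0 ν
  have hτν := Real.rpow_pos_of_pos hpos (ν + 1)
  have h2 := Real.rpow_pos_of_pos two_pos (ν + 1)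
  have hsum := sum_eq_mul_integral_floor (fun n => Real.Gamma (ν + 1 + n) /
    (n.factorial * (N : ℝ) ^ ν) * τ ^ (2 * n) *
      ‖laguerrePoly ν ((1 - τ ^ 2) / (2 * τ)) n v‖ ^ 2) hN1
  have hI : ∫ x in Ioo (0 : ℝ) 1, kernelIntegrand N c ν v x = (N : ℝ)⁻¹ *
      ∑ n ∈ Finset.range N, Real.Gamma (ν + 1 + n) / (n.factorial * (N : ℝ) ^ ν) * τ ^ (2 * n) *
      ‖laguerrePoly ν ((1 - τ ^ 2) / (2 * τ)) n v‖ ^ 2 := by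
    rw [hsum, inv_mul_cancel_left₀ hN0.ne']
    rfl
  rw [hI, laguerreKernel, Fin.sum_univ_eq_sum_range (fun k =>
    ‖laguerrePoly ν ((1 - τ ^ 2) / (2 * τ)) k v‖ ^ 2 / laguerreNorm (2 ^ (ν + 1) / d) ν τ k) N,
    Finset.mul_sum, Finset.mul_sum]
  refine Finset.sum_congr rfl fun n _ => ?_
  have hG : 0 < Real.Gamma (ν + 1 + n) := Real.Gamma_pos_of_pos (by
    have : (0 : ℝ) ≤ n := n.cast_nonneg
    linarith)
  rw [laguerreNorm, Real.mul_rpow hN0.le hpos.le, Real.rpow_neg hpos.le,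
    Real.rpow_add_one hN0.ne' ν]
  field_simp

section Limits
variable {c : ℝ}

theorem tendsto_one_sub_sq_div (c : ℝ) :
    Tendsto (fun N : ℕ => 1 - c ^ 2 / (N : ℝ)) atTop (𝓝 1) := by
  simpa using (tendsto_const_div_atTop_nhds_zero_nat (c ^ 2)).const_sub 1

theorem tendsto_mul_one_sub_sq (c : ℝ) :
    Tendsto (fun N : ℕ => (N : ℝ) * (1 - (1 - c ^ 2 / (N : ℝ)) ^ 2)) atTop (𝓝 (2 * c ^ 2)) := by
  have h := ((tendsto_one_sub_sq_div c).const_add 1).const_mul (c ^ 2)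
  rw [show c ^ 2 * (1 + 1) = 2 * c ^ 2 by ring] at h
  refine h.congr' ?_
  filter_upwards [eventually_ge_atTop 1] with N hN
  have hN0 : (N : ℝ) ≠ 0 := by positivity
  field_simp
  ring

theorem tendsto_mul_parameter (c : ℝ) :
    Tendsto (fun N : ℕ => (1 - (1 - c ^ 2 / (N : ℝ)) ^ 2) / (2 * (1 - c ^ 2 / (N : ℝ))) * N) atTop
      (𝓝 (c ^ 2)) := by
  have h := (tendsto_mul_one_sub_sq c).div ((tendsto_one_sub_sq_div c).const_mul 2) (by norm_num)
  rw [show 2 * c ^ 2 / (2 * 1) = c ^ 2 by ring] at h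
  refine h.congr fun N => ?_
  simp only [Pi.div_apply]
  ring

theorem tendsto_parameter (c : ℝ) :
    Tendsto (fun N : ℕ => (1 - (1 - c ^ 2 / (N : ℝ)) ^ 2) / (2 * (1 - c ^ 2 / (N : ℝ)))) atTop
      (𝓝 0) := by
  have h := ((tendsto_one_sub_sq_div c).pow 2).const_sub 1 |>.div
    ((tendsto_one_sub_sq_div c).const_mul 2) (by norm_num)
  rwa [one_pow, sub_self, zero_div] at h

theorem eventually_parameter_nonneg (c : ℝ) :
    ∀ᶠ N : ℕ in atTop, c ^ 2 < N ∧ 0 < 1 - c ^ 2 / (N : ℝ) ∧ 1 - c ^ 2 / (N : ℝ) ≤ 1 ∧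
      0 ≤ (1 - (1 - c ^ 2 / (N : ℝ)) ^ 2) / (2 * (1 - c ^ 2 / (N : ℝ))) := by
  filter_upwards [tendsto_natCast_atTop_atTop.eventually_gt_atTop (c ^ 2)] with N hN
  have hN0 : (0 : ℝ) < N := lt_of_le_of_lt (sq_nonneg c) hN
  have hτ0 : 0 < 1 - c ^ 2 / (N : ℝ) := by rw [sub_pos, div_lt_one hN0]; exact hN
  have hτ1 : 1 - c ^ 2 / (N : ℝ) ≤ 1 := by rw [sub_le_self_iff]; positivity
  exact ⟨hN, hτ0, hτ1, div_nonneg (by nlinarith) (by linarith)⟩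

theorem tendsto_floor_div {x : ℝ} (hx : 0 < x) :
    Tendsto (fun N : ℕ => (⌊x * N⌋₊ : ℝ) / N) atTop (𝓝 x) :=
  (tendsto_nat_floor_mul_div_atTop hx.le).comp tendsto_natCast_atTop_atTop

/-- Take logarithms: `N log(1 - c²/N) → -c²`, multiplied by `2⌊xN⌋/N → 2x`. -/
theorem tendsto_pow_floor (c : ℝ) {x : ℝ} (hx : 0 < x) :
    Tendsto (fun N : ℕ => (1 - c ^ 2 / (N : ℝ)) ^ (2 * ⌊x * N⌋₊)) atTop
      (𝓝 (Real.exp (-(2 * c ^ 2 * x)))) := by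
  have h1 : Tendsto (fun N : ℕ => (N : ℝ) * Real.log (1 + -c ^ 2 / N)) atTop (𝓝 (-c ^ 2)) :=
    (Real.tendsto_mul_log_one_add_div_atTop (-c ^ 2)).comp tendsto_natCast_atTop_atTop
  have h2 := (Real.continuous_exp.tendsto _).comp (((tendsto_floor_div hx).mul h1).const_mul 2)
  rw [show 2 * (x * -c ^ 2) = -(2 * c ^ 2 * x) by ring] at h2
  refine h2.congr' ?_
  filter_upwards [eventually_parameter_nonneg c, eventually_ge_atTop 1] with N hN hN1
  have hN0 : (N : ℝ) ≠ 0 := by positivity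
  rw [Function.comp, neg_div, ← sub_eq_add_neg, ← Real.rpow_natCast _ (2 * ⌊x * N⌋₊), Real.rpow_def_of_pos hN.2.1]
  congr 1
  push_cast
  field_simp

theorem tendsto_Gamma_floor {ν : ℝ} (hν : -1 < ν) {x : ℝ} (hx : 0 < x) :
    Tendsto (fun N : ℕ => Real.Gamma (ν + 1 + ⌊x * N⌋₊) / ((⌊x * N⌋₊).factorial * (N : ℝ) ^ ν))
      atTop (𝓝 (x ^ ν)) := by
  have hfl := tendsto_nat_floor_mul_atTop x hx
  have h1 := (tendsto_Gamma_div hν).comp hfl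
  have h2 := (tendsto_floor_div hx).rpow_const (p := ν) (Or.inl hx.ne')
  have h3 := h1.mul h2
  rw [one_mul] at h3
  refine h3.congr' ?_
  filter_upwards [hfl.eventually_ge_atTop 1, eventually_ge_atTop 1] with N hf hN
  have hf0 : (0 : ℝ) < ⌊x * N⌋₊ := by exact_mod_cast hf
  have hN0 : (0 : ℝ) < N := by exact_mod_cast hN
  have := Real.rpow_pos_of_pos hf0 ν
  have := Real.rpow_pos_of_pos hN0 ν
  rw [Function.comp, Real.div_rpow hf0.le hN0.le]
  field_simp

/-- The quotient `(n+1)/N` lies between `x` and `2`, and the sum covers both signs of `ν`. The bound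
is integrable over `(0,1)` when `ν > -1`. -/
theorem rpow_succ_div_le {ν x N n : ℝ} (hx : 0 < x) (hN : 1 ≤ N) (h1 : x * N ≤ n + 1)
    (h2 : n ≤ N) : (n + 1) ^ ν / N ^ ν ≤ x ^ ν + 2 ^ ν := by
  have hN0 : 0 < N := by linarith
  have hn : 0 < n + 1 := (mul_pos hx hN0).trans_le h1
  rw [← Real.div_rpow hn.le hN0.le]
  have hx' := Real.rpow_nonneg hx.le ν
  have h2' := Real.rpow_nonneg two_pos.le ν
  rcases le_total 0 ν with hν | hν
  · have : ((n + 1) / N) ^ ν ≤ 2 ^ ν :=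
      Real.rpow_le_rpow (by positivity) (by rw [div_le_iff₀ hN0]; linarith) hν
    linarith
  · have : ((n + 1) / N) ^ ν ≤ x ^ ν :=
      Real.rpow_le_rpow_of_nonpos hx (by rw [le_div_iff₀ hN0]; exact h1) hν
    linarith

/-- The limit is joint in `N` and `v`, since this is what gives uniformity on compact sets. -/
theorem tendsto_integral_kernelIntegrand {ν : ℝ} (hν : -1 < ν) (v₀ : ℂ) :
    Tendsto (fun p : ℕ × ℂ => ∫ x in Ioo (0 : ℝ) 1, kernelIntegrand p.1 c ν p.2 x)
      (atTop ×ˢ 𝓝 v₀) (𝓝 (∫ x in Ioo (0 : ℝ) 1, x ^ ν * Real.exp (-(2 * c ^ 2 * x)) *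
        ‖besselEntire ν ((c ^ 2 * x : ℝ) * v₀)‖ ^ 2)) := by
  obtain ⟨M, hM, hMb⟩ := exists_Gamma_div_le hν
  obtain ⟨δ, hδ, hG⟩ := exists_Gamma_ge hν
  -- Eventually `C N < c² + 1` and `|v| < |v₀| + 1`; as `n ≤ N`, this bounds `C n |v|`.
  set B := (c ^ 2 + 1) * (‖v₀‖ + 1) with hB
  set P := ∑' j : ℕ, B ^ j / j.factorial * δ⁻¹ with hP
  refine tendsto_integral_filter_of_dominated_convergence
    (fun x => M * (x ^ ν + 2 ^ ν) * P ^ 2) ?_ ?_ ?_ ?_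
  · refine Eventually.of_forall fun p => Measurable.aestronglyMeasurable ?_
    have hfl : Measurable fun x : ℝ => ⌊x * p.1⌋₊ := Nat.measurable_floor.comp (by fun_prop)
    exact (measurable_from_nat (f := fun n : ℕ => Real.Gamma (ν + 1 + n) /
      (n.factorial * (p.1 : ℝ) ^ ν) * (1 - c ^ 2 / p.1) ^ (2 * n) * ‖laguerrePoly ν
      ((1 - (1 - c ^ 2 / p.1) ^ 2) / (2 * (1 - c ^ 2 / p.1))) n p.2‖ ^ 2)).comp hfl
  · have e1 : ∀ᶠ p : ℕ × ℂ in atTop ×ˢ 𝓝 v₀, 1 ≤ p.1 :=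
      tendsto_fst.eventually (eventually_ge_atTop 1)
    have e2 := (tendsto_fst (f := atTop) (g := 𝓝 v₀)).eventually (eventually_parameter_nonneg c)
    have e3 := (tendsto_fst (f := atTop) (g := 𝓝 v₀)).eventually
      ((tendsto_mul_parameter c).eventually_lt_const (lt_add_one _))
    have e4 : ∀ᶠ p : ℕ × ℂ in atTop ×ˢ 𝓝 v₀, ‖p.2‖ < ‖v₀‖ + 1 :=
      tendsto_snd.eventually (continuous_norm.continuousAt.eventually_lt_const (lt_add_one _))
    filter_upwards [e1, e2, e3, e4] with p hp1 hp2 hp3 hp4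
    refine (ae_restrict_iff' measurableSet_Ioo).2 (ae_of_all _ fun x hx => ?_)
    obtain ⟨-, hτ0, hτ1, hC⟩ := hp2
    have hN1 : (1 : ℝ) ≤ p.1 := by exact_mod_cast hp1
    have hN0 : (0 : ℝ) < p.1 := by linarith
    rw [kernelIntegrand]
    set n := ⌊x * p.1⌋₊ with hn
    set C := (1 - (1 - c ^ 2 / (p.1 : ℝ)) ^ 2) / (2 * (1 - c ^ 2 / (p.1 : ℝ))) with hCdef
    have hnle : (n : ℝ) ≤ p.1 := (Nat.floor_le (mul_nonneg hx.1.le hN0.le)).trans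
      (mul_le_of_le_one_left hN0.le hx.2.le)
    have hnge : x * p.1 ≤ n + 1 := (Nat.lt_floor_add_one _).le
    have hCn : C * n * ‖p.2‖ ≤ B := by
      rw [hB]
      refine mul_le_mul ?_ hp4.le (norm_nonneg _) (by positivity)
      exact (mul_le_mul_of_nonneg_left hnle hC).trans hp3.le
    have hpoly := norm_laguerrePoly_le hC hδ hG hCn
    have hGn : 0 < Real.Gamma (ν + 1 + n) := hδ.trans_le (hG n)
    have hNν := Real.rpow_pos_of_pos hN0 ν
    have hg : Real.Gamma (ν + 1 + n) / (n.factorial * (p.1 : ℝ) ^ ν) ≤ M * (x ^ ν + 2 ^ ν) := by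
      rw [← div_div]
      calc _ ≤ M * ((n : ℝ) + 1) ^ ν / (p.1 : ℝ) ^ ν := by
            gcongr
            exact hMb n
        _ = M * (((n : ℝ) + 1) ^ ν / (p.1 : ℝ) ^ ν) := by ring
        _ ≤ _ := by
            gcongr
            exact rpow_succ_div_le hx.1 hN1 hnge hnle
    have hx' := Real.rpow_nonneg hx.1.le ν
    have h2' := Real.rpow_nonneg two_pos.le ν
    rw [Real.norm_of_nonneg (by positivity)]
    calc _ ≤ M * (x ^ ν + 2 ^ ν) * 1 * P ^ 2 := by
          gcongr
          exact pow_le_one₀ hτ0.le hτ1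
      _ = _ := by ring
  · have h1 : IntegrableOn (fun x : ℝ => x ^ ν) (Ioo 0 1) :=
      ((intervalIntegral.intervalIntegrable_rpow' (a := 0) (b := 1) hν).1).mono_set
        Ioo_subset_Ioc_self
    exact ((h1.add (integrableOn_const (by simp))).const_mul M).mul_const _
  · refine (ae_restrict_iff' measurableSet_Ioo).2 (ae_of_all _ fun x hx => ?_)
    have hfst := tendsto_fst (f := (atTop : Filter ℕ)) (g := 𝓝 v₀)
    refine (((tendsto_Gamma_floor hν hx.1).comp hfst).mul
      ((tendsto_pow_floor c hx.1).comp hfst)).mul (Tendsto.pow (Tendsto.norm ?_) 2)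
    refine tendsto_laguerrePoly hν (hfst.eventually ((eventually_parameter_nonneg c).mono
      fun N hN => hN.2.2.2)) ((tendsto_parameter c).comp hfst) ?_ tendsto_snd
      ((tendsto_nat_floor_mul_atTop x hx.1).comp hfst)
    have h1 := (tendsto_mul_parameter c).mul (tendsto_floor_div hx.1)
    have h2 : Tendsto (fun N : ℕ => (1 - (1 - c ^ 2 / (N : ℝ)) ^ 2) / (2 * (1 - c ^ 2 / (N : ℝ))) *
        (⌊x * N⌋₊ : ℝ)) atTop (𝓝 (c ^ 2 * x)) := by
      refine h1.congr' ?_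
      filter_upwards [eventually_ge_atTop 1] with N hN
      have hN0 : (N : ℝ) ≠ 0 := by positivity
      rw [mul_assoc, mul_div_cancel₀ _ hN0]
    exact h2.comp hfst

theorem tendsto_laguerreKernel {d : ℕ} (hd : 1 ≤ d) {ν : ℝ} (hc : 0 < c) (hν : -1 < ν) (v₀ : ℂ) :
    Tendsto (fun p : ℕ × ℂ => laguerreKernel d p.1 c ν p.2) (atTop ×ˢ 𝓝 v₀)
      (𝓝 (limitKernel d c ν v₀)) := by
  have hfst := tendsto_fst (f := (atTop : Filter ℕ)) (g := 𝓝 v₀)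
  have h1 := ((tendsto_mul_one_sub_sq c).rpow_const (p := ν + 1) (Or.inr (by linarith))).div_const
    (2 ^ (ν + 1) / (d : ℝ))
  refine ((h1.comp hfst).mul (tendsto_integral_kernelIntegrand (c := c) hν v₀)).congr' ?_
  filter_upwards [hfst.eventually (eventually_parameter_nonneg c)] with p hp
  exact (laguerreKernel_eq_integral hd hc hν hp.1 p.2).symm

end Limits

/-! ### The limit formula -/

/-- For real `ν` the modulus of the power is `|w/2|^ν` on any branch, and the remaining series
depends on `w²` only. -/
theorem norm_besselJ_sq (ν : ℝ) (w : ℂ) :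
    ‖besselJ ν w‖ ^ 2 = (‖w / 2‖ ^ ν) ^ 2 * ‖besselEntire ν ((w / 2) ^ 2)‖ ^ 2 := by
  rw [besselJ, norm_mul, mul_pow, Complex.norm_cpow_real, besselEntire]
  simp_rw [pow_mul]

theorem limitFormula_eq {d : ℕ} (hd : 1 ≤ d) {c ν : ℝ} (hc : 0 < c) {z : ℂ} (hz : z ≠ 0) :
    limitFormula d c ν z
      = besselWeight d ν z * Real.exp (z ^ d).re * limitKernel d c ν (z ^ d) := by
  have hz' : 0 < ‖z‖ := norm_pos_iff.2 hz
  have hd0 : (d : ℝ) ≠ 0 := by positivity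
  -- The substitution `x = s²/(4c²)` turns `e^{-2c²x}` into `e^{-s²/2}` and `c²x z^d` into `(s
  -- z^{d/2}/2)²`.
  have himg : (fun s : ℝ => s ^ 2 / (4 * c ^ 2)) '' Ioo 0 (2 * c) = Ioo 0 1 := by
    ext x
    constructor
    · rintro ⟨s, ⟨h0, h1⟩, rfl⟩
      refine ⟨by positivity, ?_⟩
      simp only
      rw [div_lt_one (by positivity)]
      nlinarith
    · rintro ⟨h0, h1⟩
      refine ⟨2 * c * Real.sqrt x, ⟨by positivity, ?_⟩, ?_⟩
      · have : Real.sqrt x < 1 := by rw [Real.sqrt_lt' one_pos]; simpa using h1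
        nlinarith
      · simp only
        rw [mul_pow, Real.sq_sqrt h0.le]
        field_simp
        ring
  have hinj : InjOn (fun s : ℝ => s ^ 2 / (4 * c ^ 2)) (Ioo 0 (2 * c)) := by
    intro a ha b hb hab
    have : a ^ 2 = b ^ 2 := by
      have h4 : (4 * c ^ 2) ≠ 0 := by positivity
      exact (div_left_inj' h4).1 hab
    exact (pow_left_inj₀ ha.1.le hb.1.le two_ne_zero).1 this
  have hder : ∀ s ∈ Ioo 0 (2 * c), HasDerivWithinAt (fun s : ℝ => s ^ 2 / (4 * c ^ 2))
      (s / (2 * c ^ 2)) (Ioo 0 (2 * c)) s := by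
    intro s _
    have := ((hasDerivAt_pow 2 s).div_const (4 * c ^ 2)).hasDerivWithinAt (s := Ioo 0 (2 * c))
    refine this.congr_deriv ?_
    field_simp
    ring
  have hcv := integral_image_eq_integral_abs_deriv_smul measurableSet_Ioo hder hinj
    (fun x => x ^ ν * Real.exp (-(2 * c ^ 2 * x)) *
      ‖besselEntire ν ((c ^ 2 * x : ℝ) * z ^ d)‖ ^ 2)
  rw [himg] at hcv
  rw [limitFormula, limitKernel, hcv, intervalIntegral.integral_of_le (by positivity),
    integral_Ioc_eq_integral_Ioo, ← integral_const_mul, ← integral_const_mul, ← integral_const_mul]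
  refine setIntegral_congr_fun measurableSet_Ioo fun s hs => ?_
  have hs0 : 0 < s := hs.1
  have hroot : (z ^ ((d : ℂ) / 2)) ^ 2 = z ^ d := by
    rw [← Complex.cpow_nat_mul, ← Complex.cpow_natCast]
    congr 1
    push_cast
    ring
  have harg : ((s : ℂ) * z ^ ((d : ℂ) / 2) / 2) ^ 2
      = ((c ^ 2 * (s ^ 2 / (4 * c ^ 2)) : ℝ) : ℂ) * z ^ d := by
    have : (c : ℂ) ≠ 0 := by exact_mod_cast hc.ne'
    rw [div_pow, mul_pow, hroot]
    push_cast
    field_simp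
    ring
  have hnorm : (‖(s : ℂ) * z ^ ((d : ℂ) / 2) / 2‖ ^ ν) ^ 2
      = ((s ^ 2 / (4 * c ^ 2)) * c ^ 2) ^ ν * ‖z‖ ^ ((d : ℝ) * ν) := by
    have h1 : ‖(s : ℂ) * z ^ ((d : ℂ) / 2) / 2‖ ^ 2 = (s ^ 2 / (4 * c ^ 2)) * c ^ 2 * ‖z‖ ^ d := by
      rw [← norm_pow, harg, norm_mul, norm_pow, Complex.norm_real,
        Real.norm_of_nonneg (by positivity)]
      ring
    rw [← Real.rpow_natCast, ← Real.rpow_mul (norm_nonneg _), mul_comm ν, Real.rpow_mul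
      (norm_nonneg _), Real.rpow_natCast, h1, Real.mul_rpow (by positivity) (by positivity),
      Real.rpow_mul (norm_nonneg z), Real.rpow_natCast]
  have hpow : ‖z‖ ^ (2 * d - 2) * ‖z‖ ^ ((d : ℝ) * ν) = ‖z‖ ^ ((d : ℝ) * (ν + 2) - 2) := by
    rw [← Real.rpow_natCast, ← Real.rpow_add hz', Nat.cast_sub (by omega)]
    congr 1
    push_cast
    ring
  have hx0 : 0 < s ^ 2 / (4 * c ^ 2) := by positivity
  have hexp : -(2 * c ^ 2 * (s ^ 2 / (4 * c ^ 2))) = -s ^ 2 / 2 := by field_simp; ring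
  have hcoef : (2 * c ^ 2) ^ (ν + 1) / (2 ^ (ν + 1) / (d : ℝ)) * (s / (2 * c ^ 2))
      = d / 2 * s * (c ^ 2) ^ ν := by
    have := Real.rpow_pos_of_pos two_pos (ν + 1)
    rw [Real.mul_rpow two_pos.le (by positivity), Real.rpow_add_one (by positivity : c ^ 2 ≠ 0)]
    field_simp
  simp only [smul_eq_mul]
  rw [norm_besselJ_sq, hnorm, harg, abs_of_pos (by positivity), hexp, besselWeight, ← hpow,
    Real.mul_rpow hx0.le (by positivity)]
  linear_combination -(‖z‖ ^ (2 * d - 2) * ‖z‖ ^ ((d : ℝ) * ν) * besselK ν (‖z‖ ^ d) *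
    Real.exp (z ^ d).re * (s ^ 2 / (4 * c ^ 2)) ^ ν * Real.exp (-s ^ 2 / 2) *
    ‖besselEntire ν (((c ^ 2 * (s ^ 2 / (4 * c ^ 2)) : ℝ) : ℂ) * z ^ d)‖ ^ 2) * hcoef

/-! ### Continuous convergence -/

/-- Fix a nearby `y` and let `n → ∞` in the joint estimate; no continuity of the functions `F n` is
needed. -/
theorem continuousAt_of_tendsto_prod {X : Type*} [TopologicalSpace X] {F : ℕ → X → ℝ} {f : X → ℝ}
    {U : Set X} (hU : IsOpen U)
    (h : ∀ x ∈ U, Tendsto (fun p : ℕ × X => F p.1 p.2) (atTop ×ˢ 𝓝 x) (𝓝 (f x))) {x : X}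
    (hx : x ∈ U) : ContinuousAt f x := by
  refine Metric.tendsto_nhds.2 fun ε hε => ?_
  have h1 := (Metric.tendsto_nhds.1 (h x hx)) (ε / 2) (half_pos hε)
  obtain ⟨pa, ha, pb, hb, hab⟩ := eventually_prod_iff.1 h1
  filter_upwards [hb, hU.mem_nhds hx] with y hy hyU
  have h2 : Tendsto (fun n => F n y) atTop (𝓝 (f y)) :=
    (h y hyU).comp (tendsto_id.prodMk (tendsto_const_nhds.mono_right le_rfl))
  have h3 : dist (f y) (f x) ≤ ε / 2 :=
    le_of_tendsto (h2.dist tendsto_const_nhds) (ha.mono fun n hn => (hab hn hy).le)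
  linarith

theorem tendstoUniformlyOn_of_tendsto_prod {X : Type*} [TopologicalSpace X] {F : ℕ → X → ℝ}
    {f : X → ℝ} {U : Set X} (hU : IsOpen U)
    (h : ∀ x ∈ U, Tendsto (fun p : ℕ × X => F p.1 p.2) (atTop ×ˢ 𝓝 x) (𝓝 (f x))) {K : Set X}
    (hK : IsCompact K) (hKU : K ⊆ U) : TendstoUniformlyOn F f atTop K := by
  rw [← tendstoLocallyUniformlyOn_iff_tendstoUniformlyOn_of_compact hK,
    Metric.tendstoLocallyUniformlyOn_iff]
  intro ε hε x hx
  have h1 := (Metric.tendsto_nhds.1 (h x (hKU hx))) (ε / 2) (half_pos hε)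
  obtain ⟨pa, ha, pb, hb, hab⟩ := eventually_prod_iff.1 h1
  have h2 := Metric.tendsto_nhds.1 (continuousAt_of_tendsto_prod hU h (hKU hx)) (ε / 2)
    (half_pos hε)
  refine ⟨_, mem_nhdsWithin_of_mem_nhds (hb.and h2), ha.mono fun n hn y hy => ?_⟩
  have := dist_triangle_right (f y) (F n y) (f x)
  have h3 := hab hn hy.1
  have h4 := hy.2
  linarith

theorem tendsto_rescaled {d : ℕ} (hd : 1 ≤ d) {c ν : ℝ} (hc : 0 < c) (hν : -1 < ν) {w : ℂ → ℝ}
    {z₀ : ℂ} (hw : ContinuousAt w z₀) :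
    Tendsto (fun p : ℕ × ℂ => w p.2 * Real.exp ((1 - c ^ 2 / p.1) * (p.2 ^ d).re) *
      laguerreKernel d p.1 c ν (p.2 ^ d)) (atTop ×ˢ 𝓝 z₀)
      (𝓝 (w z₀ * Real.exp (z₀ ^ d).re * limitKernel d c ν (z₀ ^ d))) := by
  have hfst := tendsto_fst (f := (atTop : Filter ℕ)) (g := 𝓝 z₀)
  have hsnd := tendsto_snd (f := (atTop : Filter ℕ)) (g := 𝓝 z₀)
  have hk := tendsto_laguerreKernel hd hc hν (z₀ ^ d)
  generalize limitKernel d c ν (z₀ ^ d) = a at hk ⊢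
  obtain ⟨G, hG⟩ : ∃ G : ℕ → ℂ → ℝ, ∀ N v, laguerreKernel d N c ν v = G N v :=
    ⟨_, fun _ _ => rfl⟩
  simp only [hG] at hk ⊢
  have hpow : Tendsto (fun z : ℂ => z ^ d) (𝓝 z₀) (𝓝 (z₀ ^ d)) := (continuous_pow d).tendsto z₀
  have hre : Tendsto (fun z : ℂ => (z ^ d).re) (𝓝 z₀) (𝓝 (z₀ ^ d).re) :=
    (Complex.continuous_re.tendsto _).comp hpow
  have h1 : Tendsto (fun p : ℕ × ℂ => (1 - c ^ 2 / (p.1 : ℝ)) * (p.2 ^ d).re) (atTop ×ˢ 𝓝 z₀)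
      (𝓝 (1 * (z₀ ^ d).re)) := ((tendsto_one_sub_sq_div c).comp hfst).mul (hre.comp hsnd)
  rw [one_mul] at h1
  have h2 : Tendsto (fun p : ℕ × ℂ => Real.exp ((1 - c ^ 2 / (p.1 : ℝ)) * (p.2 ^ d).re))
      (atTop ×ˢ 𝓝 z₀) (𝓝 (Real.exp (z₀ ^ d).re)) := (Real.continuous_exp.tendsto _).comp h1
  have h3 : Tendsto (fun p : ℕ × ℂ => w p.2) (atTop ×ˢ 𝓝 z₀) (𝓝 (w z₀)) := hw.tendsto.comp hsnd
  have h4 : Tendsto (fun p : ℕ × ℂ => (p.1, p.2 ^ d)) (atTop ×ˢ 𝓝 z₀) (atTop ×ˢ 𝓝 (z₀ ^ d)) :=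
    hfst.prodMk (hpow.comp hsnd)
  exact (h3.mul h2).mul (hk.comp h4)

/-- Uniform convergence and continuity of the limit, for any weight function `w` that agrees with
the limits of `besselWeight` on `U`. -/
theorem tendstoUniformlyOn_rescaledOnePoint {d : ℕ} (hd : 1 ≤ d) {c ν : ℝ} (hc : 0 < c)
    (hν : -1 < ν) {w : ℂ → ℝ} {U : Set ℂ} (hU : IsOpen U) (hw : ∀ z ∈ U, ContinuousAt w z)
    (hw' : ∀ z ∈ U, Tendsto (besselWeight d ν) (𝓝[≠] z) (𝓝 (w z))) :
    (∀ z ∈ U, ContinuousAt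
      (fun z => w z * Real.exp (z ^ d).re * limitKernel d c ν (z ^ d)) z) ∧
    ∀ K, IsCompact K → K ⊆ U → TendstoUniformlyOn (fun N : ℕ => rescaledOnePoint d N c ν)
      (fun z => w z * Real.exp (z ^ d).re * limitKernel d c ν (z ^ d)) atTop K := by
  have h := fun z hz => tendsto_rescaled hd hc hν (hw z hz)
  refine ⟨fun z hz => continuousAt_of_tendsto_prod
    (F := fun N z => w z * Real.exp ((1 - c ^ 2 / N) * (z ^ d).re) * laguerreKernel d N c ν (z ^ d))
    hU h hz, fun K hK hKU => ?_⟩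
  refine (tendstoUniformlyOn_of_tendsto_prod
    (F := fun N z => w z * Real.exp ((1 - c ^ 2 / N) * (z ^ d).re) * laguerreKernel d N c ν (z ^ d))
    hU h hK hKU).congr ?_
  filter_upwards [eventually_parameter_nonneg c] with N hN z hz
  exact (rescaledOnePoint_eq hd hc hν hN.1 (hw' z (hKU hz))).symm

end ChiralALUE

/-! ### The theorem. -/

theorem mainTheorem11 (d : ℕ) (hd : 1 ≤ d) (c ν : ℝ) (hc : 0 < c) (hν : -1 < ν) :
    (∀ᶠ N : ℕ in atTop,
      IsProbabilityMeasure (ChiralALUE.ensemble d N c ν) ∧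
      ∀ ζ : ℂ, (ζ ≠ 0 ∨ ChiralALUE.BoundedAtOrigin d ν) →
        ∃ ρ : ℝ, Tendsto (ChiralALUE.intensityQuotient (ChiralALUE.ensemble d N c ν) ζ)
          (𝓝[>] (0 : ℝ)) (𝓝 ρ)) ∧
    (∀ K : Set ℂ, IsCompact K → (0 : ℂ) ∉ K →
      TendstoUniformlyOn (fun N : ℕ => ChiralALUE.rescaledOnePoint d N c ν)
        (ChiralALUE.limitDensity d c ν) atTop K) ∧
    (ChiralALUE.BoundedAtOrigin d ν →
      ContinuousAt (ChiralALUE.limitDensity d c ν) 0 ∧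
      ∀ K : Set ℂ, IsCompact K →
        TendstoUniformlyOn (fun N : ℕ => ChiralALUE.rescaledOnePoint d N c ν)
          (ChiralALUE.limitDensity d c ν) atTop K) := by
  open ChiralALUE in
  refine ⟨?_, ?_, ?_⟩
  · filter_upwards [eventually_parameter_nonneg c] with N hN
    obtain ⟨hP, hlim⟩ := ensemble_spec hd hc hν hN.1
    refine ⟨hP, fun ζ hζ => ?_⟩
    have hN0 : (0 : ℝ) < N := lt_of_le_of_lt (sq_nonneg c) hN.1
    have hα0 : (((c / N) ^ (2 / (d : ℝ)) : ℝ) : ℂ) ≠ 0 := by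
      exact_mod_cast (by positivity : (0 : ℝ) < (c / N) ^ (2 / (d : ℝ))).ne'
    obtain ⟨w, hw⟩ : ∃ w : ℝ, Tendsto (besselWeight d ν)
        (𝓝[≠] ((((c / N) ^ (2 / (d : ℝ)) : ℝ) : ℂ)⁻¹ * ζ)) (𝓝 w) := by
      by_cases h0 : ζ = 0
      · rw [h0, mul_zero]
        exact exists_tendsto_besselWeight_zero hd (hζ.resolve_left fun h => h h0)
      · exact ⟨_, (tendsto_besselWeight d ν
          (mul_ne_zero (inv_ne_zero hα0) h0)).tendsto.mono_left nhdsWithin_le_nhds⟩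
    have := hlim _ w hw
    rw [mul_inv_cancel_left₀ hα0] at this
    exact ⟨_, this⟩
  · intro K hK h0
    have hc0 : ∀ z ∈ ({0}ᶜ : Set ℂ), ContinuousAt (besselWeight d ν) z := fun z hz =>
      tendsto_besselWeight d ν hz
    refine ((tendstoUniformlyOn_rescaledOnePoint hd hc hν isOpen_compl_singleton hc0
      fun z hz => (hc0 z hz).tendsto.mono_left nhdsWithin_le_nhds).2 K hK
      (fun z hz h => h0 (h ▸ hz))).congr_right fun z hz => ?_
    have hz0 : z ≠ 0 := fun h => h0 (h ▸ hz)
    rw [limitDensity, Function.update_of_ne hz0, limitFormula_eq hd hc hz0]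
  · intro hbd
    obtain ⟨w₀, hw₀⟩ := exists_tendsto_besselWeight_zero hd hbd
    -- Under `(*)` the weight extended by its limit `w₀` at the origin is continuous on the whole
    -- plane, so the convergence result applies with `U = univ`.
    have hupd : ∀ z ∈ (univ : Set ℂ), ContinuousAt (Function.update (besselWeight d ν) 0 w₀) z := by
      intro z _
      by_cases hz : z = 0
      · rw [hz, continuousAt_update_same]; exact hw₀
      · exact (continuousAt_update_of_ne hz).2 (tendsto_besselWeight d ν hz)
    have hlim : ∀ z ∈ (univ : Set ℂ), Tendsto (besselWeight d ν) (𝓝[≠] z)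
        (𝓝 (Function.update (besselWeight d ν) 0 w₀ z)) := by
      intro z _
      by_cases hz : z = 0
      · rw [hz, Function.update_self]; exact hw₀
      · rw [Function.update_of_ne hz]
        exact (tendsto_besselWeight d ν hz).tendsto.mono_left nhdsWithin_le_nhds
    obtain ⟨h1, h2⟩ := tendstoUniformlyOn_rescaledOnePoint hd hc hν isOpen_univ hupd hlim
    have heq : limitDensity d c ν = fun z => Function.update (besselWeight d ν) 0 w₀ z *
        Real.exp (z ^ d).re * limitKernel d c ν (z ^ d) := by
      have hne : ∀ z : ℂ, z ≠ 0 → limitFormula d c ν z = Function.update (besselWeight d ν) 0 w₀ z *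
          Real.exp (z ^ d).re * limitKernel d c ν (z ^ d) := fun z hz => by
        rw [Function.update_of_ne hz, limitFormula_eq hd hc hz]
      ext z
      by_cases hz : z = 0
      · rw [hz, limitDensity, Function.update_self]
        -- The value of `limitDensity` at `0` is a punctured limit, identified through the
        -- continuity of the extended product.
        refine Tendsto.limUnder_eq (((h1 0 (mem_univ _)).tendsto.mono_left
          nhdsWithin_le_nhds).congr' ?_)
        filter_upwards [self_mem_nhdsWithin] with y hy
        exact (hne y hy).symm
      · rw [limitDensity, Function.update_of_ne hz, hne z hz]
    rw [heq]
    exact ⟨h1 0 (mem_univ _), fun K hK => h2 K hK (subset_univ K)⟩
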